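/- Let $0<p<q$ and $\tau=p/q\in(0,1)$. Let $\eta(t)=(\eta_x(t))_{x\in\mathbb Z}\in\{0,1\}^{\mathbb Z}$, $t\ge 0$, be the asymmetric simple exclusion process (ASEP) on $\mathbb Z$ in which particles jump to the right with rate $p$ and to the left with rate $q$, with an arbitrary initial distribution (for example the two-sided Bernoulli one). That is, $\eta$ has right-continuous paths with left limits and solves the martingale problem of the generator $$Lf(\eta)=\sum_{x\in\mathbb Z}\bigl(p\,\eta_x(1-\eta_{x+1})+q\,(1-\eta_x)\eta_{x+1}\bigr)\bigl[f(\eta^{x,x+1})-f(\eta)\bigr]$$ for all cylinder functions $f$, where $\eta^{x,x+1}$ is $\eta$ with $\eta_x,\eta_{x+1}$ exchanged. Let $Q(0,t)$ be the number of jumps from site $1$ to site $0$ minus the number of jumps from site $0$ to site $1$ during $(0,t]$, and let $$N(x,t)=Q(0,t)+\begin{cases}\sum_{y=1}^{x}\eta_y(t), & x>0,\\ 0, & x=0,\\ -\sum_{y=x+1}^{0}\eta_y(t), & x<0.\end{cases}$$ For $n\in\mathbb Z$ put $$a_n=\frac{q(1-\tau^{-n})(-\tau^3+\tau^n)}{(1-\tau)^2},\quad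 b_n=\frac{p(1-\tau^{-n})(\tau^2-\tau^n)}{(1-\tau)^2},\quad c_n=\frac{q(1-\tau^{-n})(\tau^2-\tau^n)}{(1-\tau)^2},\quad d_n=\frac{p(1-\tau^{-n})(-\tau+\tau^n)}{(1-\tau)^2},$$ and $$v_n(x,t)=\tau^{(n-2)N(x,t)}\Bigl(a_n\tau^{2N(x,t)}+b_n\tau^{N(x,t)+N(x-1,t)}+c_n\tau^{N(x,t)+N(x+1,t)}+d_n\tau^{N(x+1,t)+N(x-1,t)}\Bigr).$$ Write $\langle\cdot\rangle$ for the expectation. Then all expectations below are those of integrable random variables, and, for every $t\ge0$ (with the one-sided derivative at $t=0$): 1. for all $n\in\mathbb Z$ and $x\in\mathbb Z$, $$\frac{d}{dt}\bigl\langle\tau^{nN(x,t)}\bigr\rangle=\bigl\langle v_n(x,t)\bigr\rangle;$$ 2. for all $k\ge 0$, distinct sites $y_1,\dots,y_k\in\mathbb Z$ and multiplicities $m_1,\dots,m_k\in\mathbb Z$, $$\frac{d}{dt}\Bigl\langle\prod_{i=1}^k\tau^{m_iN(y_i,t)}\Bigr\rangle=\sum_{j=1}^k\Bigl\langle v_{m_j}(y_j,t)\prod_{i\ne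 j}\tau^{m_iN(y_i,t)}\Bigr\rangle.$$ -/

import Mathlib

open MeasureTheory ProbabilityTheory Filter Topology
open scoped NNReal

noncomputable section

namespace ASEP

/-- Particle configurations on `ℤ`: `η x = true` means that the site `x` is occupied. -/
abbrev Config : Type := ℤ → Bool

/-- The occupation variable `η_x ∈ {0, 1}`. -/
def occ (η : Config) (x : ℤ) : ℤ := if η x then 1 else 0

/-- The configuration `η^{x,x+1}`, with the occupations of `x` and `x + 1` exchanged. -/
def exchange (η : Config) (x : ℤ) : Config := fun z => η (Equiv.swap x (x + 1) z)

/-- The rate `p η_x (1 - η_{x+1}) + q (1 - η_x) η_{x+1}` of an exchange over the bond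
`(x, x + 1)`: particles jump right with rate `p` and left with rate `q`. -/
def rate (p q : ℝ) (η : Config) (x : ℤ) : ℝ :=
  p * (occ η x : ℝ) * (1 - (occ η (x + 1) : ℝ)) + q * (1 - (occ η x : ℝ)) * (occ η (x + 1) : ℝ)

/-- Cylinder functions: functions of finitely many occupation variables. -/
def IsCylinder (f : Config → ℝ) : Prop := ∃ S : Finset ℤ, DependsOn f (S : Set ℤ)

/-- The generator of the ASEP. For a cylinder function `f` only finitely many terms of the
sum are nonzero. -/
def generator (p q : ℝ) (f : Config → ℝ) (η : Config) : ℝ :=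
  ∑ᶠ x : ℤ, rate p q η x * (f (exchange η x) - f η)

/-- `η` is an asymmetric simple exclusion process on `ℤ` with jump rates `p` (to the right) and
`q` (to the left), with respect to the filtration `ℱ` and the law `μ`: it is adapted, all its paths
are right-continuous with left limits in the product space `{0,1}^ℤ`, and it solves the
martingale problem of the generator on cylinder functions. The law of `η 0` is arbitrary. -/
structure IsASEP {Ω : Type*} {mΩ : MeasurableSpace Ω} (p q : ℝ) (η : ℝ≥0 → Ω → Config)
    (ℱ : Filtration ℝ≥0 mΩ) (μ : Measure Ω) : Prop where
  measurable : ∀ t x, Measurable[ℱ t] (fun ω => η t ω x)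
  right_continuous : ∀ ω t, ContinuousWithinAt (fun s => η s ω) (Set.Ici t) t
  left_limits : ∀ ω t, ∃ ζ : Config, Tendsto (fun s => η s ω) (𝓝[<] t) (𝓝 ζ)
  martingale : ∀ f : Config → ℝ, IsCylinder f →
    Martingale (fun (t : ℝ≥0) ω =>
      f (η t ω) - ∫ s in (0 : ℝ)..(t : ℝ), generator p q f (η s.toNNReal ω)) ℱ μ

/-- The times in `(0, t]` at which, along the path `γ`, a particle jumps from `x` to `x'`: just
before, `x` is occupied and `x'` is empty, and then it is the other way round. -/
def jumpTimes (γ : ℝ≥0 → Config) (x x' : ℤ) (t : ℝ≥0) : Set ℝ≥0 :=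
  {s | s ∈ Set.Ioc 0 t ∧ (∀ᶠ r in 𝓝[<] s, γ r x = true ∧ γ r x' = false) ∧
    γ s x = false ∧ γ s x' = true}

/-- The time-integrated current `Q(x, t)` through the bond `(x, x + 1)`, counted positively from
right to left: the number of jumps from `x + 1` to `x` minus the number of jumps from `x` to
`x + 1` in `(0, t]`. (Both numbers are finite when `γ` is right-continuous with left limits.) -/
def current (γ : ℝ≥0 → Config) (x : ℤ) (t : ℝ≥0) : ℤ :=
  ((jumpTimes γ (x + 1) x t).ncard : ℤ) - ((jumpTimes γ x (x + 1) t).ncard : ℤ)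

/-- The local height `N(x, t)`: the current `Q(0, t)`, plus `∑_{y=1}^{x} η_y(t)` if `x > 0`, minus
`∑_{y=x+1}^{0} η_y(t)` if `x ≤ 0` (an empty sum if `x = 0`). -/
def height (γ : ℝ≥0 → Config) (x : ℤ) (t : ℝ≥0) : ℤ :=
  current γ 0 t +
    if 0 < x then ∑ y ∈ Finset.Icc 1 x, occ (γ t) y
    else -∑ y ∈ Finset.Icc (x + 1) 0, occ (γ t) y

/-- The coefficient `a_n`, where `τ = p / q`. -/
def coeffA (p q : ℝ) (n : ℤ) : ℝ :=
  q * (1 - (p / q) ^ (-n)) * (-(p / q) ^ 3 + (p / q) ^ n) / (1 - p / q) ^ 2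

/-- The coefficient `b_n`, where `τ = p / q`. -/
def coeffB (p q : ℝ) (n : ℤ) : ℝ :=
  p * (1 - (p / q) ^ (-n)) * ((p / q) ^ 2 - (p / q) ^ n) / (1 - p / q) ^ 2

/-- The coefficient `c_n`, where `τ = p / q`. -/
def coeffC (p q : ℝ) (n : ℤ) : ℝ :=
  q * (1 - (p / q) ^ (-n)) * ((p / q) ^ 2 - (p / q) ^ n) / (1 - p / q) ^ 2

/-- The coefficient `d_n`, where `τ = p / q`. -/
def coeffD (p q : ℝ) (n : ℤ) : ℝ :=
  p * (1 - (p / q) ^ (-n)) * (-(p / q) + (p / q) ^ n) / (1 - p / q) ^ 2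

/-- The random variable
`τ^{(n-2)N(x)} (a_n τ^{2N(x)} + b_n τ^{N(x)+N(x-1)} + c_n τ^{N(x)+N(x+1)} + d_n τ^{N(x+1)+N(x-1)})`
at time `t` along the path `γ`, where `τ = p / q`. -/
def evolutionTerm (p q : ℝ) (n : ℤ) (γ : ℝ≥0 → Config) (x : ℤ) (t : ℝ≥0) : ℝ :=
  (p / q) ^ ((n - 2) * height γ x t) *
    (coeffA p q n * (p / q) ^ (2 * height γ x t)
      + coeffB p q n * (p / q) ^ (height γ x t + height γ (x - 1) t)
      + coeffC p q n * (p / q) ^ (height γ x t + height γ (x + 1) t)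
      + coeffD p q n * (p / q) ^ (height γ (x + 1) t + height γ (x - 1) t))

end ASEP

end

noncomputable section

namespace ASEP

/-! ### Cylinder functions -/

/-! Every height is the current `Q(0,t)` plus a function of finitely many occupations, so `∏ τ^(m_i
N(y_i,t)) = τ^(m Q(0,t)) g(η(t))` with `m = ∑ m_i` and `g` a cylinder function. The martingale
problem does not apply directly, since `Q(0,t)` depends on the whole path. It is therefore replaced
by the net number of crossings of the bond `(0,1)` seen along a grid of mesh `δ`.

In one grid step the weight accumulated so far is known at the start of the step, and the new factor
is a cylinder function of the endpoint once the starting occupations of `0` and `1` are fixed. Using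
the martingale problem twice (for `f` and for its generator) expands the expectation to first order
in `δ`, with error `O(δ²)` times the expected weight. The first-order term is the generator tilted
by the crossings (`exists_abs_gridMoment_succ_sub_le`). A discrete Gronwall argument bounds
exponential moments uniformly over the grids, and summing the steps gives a quadratic error over
macroscopic times.

Along each path a fine enough grid sees the current exactly (`jumpsSeen`). Uniform second moments
carry this to expectations, which gives the derivative (`hasDerivWithinAt_currentMoment`). It
remains to compute the tilted generator: an exchange over `(x,x+1)` changes the height at `x` alone,
by `η_{x+1} - η_x`. Over distinct sites the generator thus acts on one factor at a time, and
`heightRate_eq` identifies each rate with `a_n, b_n, c_n, d_n`. -/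

lemma IsCylinder.intro {f : Config → ℝ} (S : Finset ℤ)
    (h : ∀ η ξ : Config, (∀ x ∈ S, η x = ξ x) → f η = f ξ) : IsCylinder f :=
  ⟨S, fun η ξ hηξ => h η ξ fun x hx => hηξ x (by exact_mod_cast hx)⟩

lemma IsCylinder.elim {f : Config → ℝ} (hf : IsCylinder f) :
    ∃ S : Finset ℤ, ∀ η ξ : Config, (∀ x ∈ S, η x = ξ x) → f η = f ξ := by
  obtain ⟨S, hS⟩ := hf
  exact ⟨S, fun η ξ h => hS fun x hx => h x (by exact_mod_cast hx)⟩

lemma IsCylinder.const (c : ℝ) : IsCylinder fun _ => c :=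
  .intro ∅ fun _ _ _ => rfl

lemma IsCylinder.map₂ {f g : Config → ℝ} (F : ℝ → ℝ → ℝ) (hf : IsCylinder f)
    (hg : IsCylinder g) : IsCylinder fun η => F (f η) (g η) := by
  obtain ⟨S, hS⟩ := hf.elim
  obtain ⟨T, hT⟩ := hg.elim
  refine .intro (S ∪ T) fun η ξ h => ?_
  rw [hS η ξ fun x hx => h x (Finset.mem_union_left _ hx),
    hT η ξ fun x hx => h x (Finset.mem_union_right _ hx)]

lemma IsCylinder.mul {f g : Config → ℝ} (hf : IsCylinder f) (hg : IsCylinder g) :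
    IsCylinder fun η => f η * g η := hf.map₂ (· * ·) hg

lemma IsCylinder.sub {f g : Config → ℝ} (hf : IsCylinder f) (hg : IsCylinder g) :
    IsCylinder fun η => f η - g η := hf.map₂ (· - ·) hg

lemma IsCylinder.sum {ι : Type*} (s : Finset ι) {f : ι → Config → ℝ}
    (hf : ∀ i ∈ s, IsCylinder (f i)) : IsCylinder fun η => ∑ i ∈ s, f i η := by
  classical
  induction s using Finset.induction_on with
  | empty => simpa using IsCylinder.const 0
  | insert a s ha ih =>
    simp only [Finset.sum_insert ha]
    exact (hf a (by simp)).map₂ (· + ·) (ih fun i hi => hf i (by simp [hi]))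

lemma IsCylinder.prod {ι : Type*} (s : Finset ι) {f : ι → Config → ℝ}
    (hf : ∀ i ∈ s, IsCylinder (f i)) : IsCylinder fun η => ∏ i ∈ s, f i η := by
  classical
  induction s using Finset.induction_on with
  | empty => simpa using IsCylinder.const 1
  | insert a s ha ih =>
    simp only [Finset.prod_insert ha]
    exact (hf a (by simp)).mul (ih fun i hi => hf i (by simp [hi]))

lemma IsCylinder.comp_exchange {f : Config → ℝ} (hf : IsCylinder f) (x : ℤ) :
    IsCylinder fun η => f (exchange η x) := by
  obtain ⟨S, hS⟩ := hf.elim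
  refine .intro (S.image (Equiv.swap x (x + 1))) fun η ξ h => hS _ _ fun z hz => ?_
  exact h _ (Finset.mem_image_of_mem _ hz)

lemma isCylinder_rate (p q : ℝ) (x : ℤ) : IsCylinder fun η => rate p q η x := by
  refine .intro {x, x + 1} fun η ξ h => ?_
  have h1 := h x (by simp)
  have h2 := h (x + 1) (by simp)
  simp [rate, occ, h1, h2]

lemma exchange_apply_of_ne {η : Config} {x z : ℤ} (h1 : z ≠ x) (h2 : z ≠ x + 1) :
    exchange η x z = η z := by
  simp [exchange, Equiv.swap_apply_of_ne_of_ne h1 h2]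

@[simp] lemma exchange_left (η : Config) (x : ℤ) : exchange η x x = η (x + 1) := by
  simp [exchange]

@[simp] lemma exchange_right (η : Config) (x : ℤ) : exchange η x (x + 1) = η x := by
  simp [exchange]

lemma IsCylinder.exists_generator_eq_sum {f : Config → ℝ} (hf : IsCylinder f) (p q : ℝ) :
    ∃ T : Finset ℤ, ∀ η,
      generator p q f η = ∑ x ∈ T, rate p q η x * (f (exchange η x) - f η) := by
  obtain ⟨S, hS⟩ := hf.elim
  -- The bond `(x, x + 1)` meets `S` only if `x ∈ S` or `x + 1 ∈ S`, whatever the configuration.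
  refine ⟨S ∪ S.image (· - 1), fun η => finsum_eq_sum_of_support_subset _ fun x hx => ?_⟩
  by_contra hxT
  simp only [Finset.coe_union, Finset.coe_image, Set.mem_union, Finset.mem_coe, Set.mem_image,
    not_or, not_exists, not_and] at hxT
  refine hx ?_
  have : f (exchange η x) = f η := hS _ _ fun z hz =>
    exchange_apply_of_ne (fun h => hxT.1 (h ▸ hz)) fun h => hxT.2 z hz (by omega)
  simp [this]

lemma IsCylinder.generator {f : Config → ℝ} (hf : IsCylinder f) (p q : ℝ) :
    IsCylinder (generator p q f) := by
  obtain ⟨T, hT⟩ := hf.exists_generator_eq_sum p q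
  rw [funext hT]
  exact .sum T fun x _ => (isCylinder_rate p q x).mul ((hf.comp_exchange x).sub hf)

/-- Factoring through the finite type `S → Bool` makes boundedness and measurability automatic. -/
lemma IsCylinder.exists_comp_restrict {f : Config → ℝ} (hf : IsCylinder f) :
    ∃ (S : Finset ℤ) (F : (S → Bool) → ℝ), ∀ η, f η = F fun x => η x := by
  obtain ⟨S, hS⟩ := hf.elim
  refine ⟨S, fun a => f fun x => if h : x ∈ S then a ⟨x, h⟩ else false, fun η => hS _ _ ?_⟩
  intro x hx
  simp [hx]

lemma IsCylinder.exists_bound {f : Config → ℝ} (hf : IsCylinder f) :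
    ∃ C, 0 ≤ C ∧ ∀ η, |f η| ≤ C := by
  obtain ⟨S, F, hF⟩ := hf.exists_comp_restrict
  refine ⟨∑ a, |F a|, Finset.sum_nonneg fun _ _ => abs_nonneg _, fun η => ?_⟩
  rw [hF]
  exact Finset.single_le_sum (f := fun a => |F a|) (fun _ _ => abs_nonneg _) (Finset.mem_univ _)

lemma IsCylinder.measurable_comp {Ω : Type*} {m : MeasurableSpace Ω} {f : Config → ℝ}
    (hf : IsCylinder f) {X : Ω → Config} (hX : ∀ x, Measurable fun ω => X ω x) :
    Measurable fun ω => f (X ω) := by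
  obtain ⟨S, F, hF⟩ := hf.exists_comp_restrict
  simp only [hF]
  exact (measurable_of_finite F).comp (measurable_pi_lambda _ fun x => hX x)

lemma IsCylinder.eventually_eq {ι : Type*} {l : Filter ι} {f : Config → ℝ} (hf : IsCylinder f)
    {X : ι → Config} {ζ : Config} (hX : Tendsto X l (𝓝 ζ)) : ∀ᶠ i in l, f (X i) = f ζ := by
  obtain ⟨S, hS⟩ := hf.elim
  have : ∀ᶠ i in l, ∀ x ∈ S, X i x = ζ x := (eventually_all_finset S).2 fun x _ => by
    have h := tendsto_pi_nhds.1 hX x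
    rw [nhds_discrete, tendsto_pure] at h
    exact h
  exact this.mono fun i hi => hS _ _ hi

/-! ### Crossings of the bond `(0, 1)` -/

/-- The indicator that passing from `ζ` to `ξ` moves a particle from `x` to `x'`. -/
def hop (ζ ξ : Config) (x x' : ℤ) : ℤ :=
  if ζ x = true ∧ ζ x' = false ∧ ξ x = false ∧ ξ x' = true then 1 else 0

/-- The net number of particles passing from `1` to `0` in a transition from `ζ` to `ξ`. -/
def crossing (ζ ξ : Config) : ℤ := hop ζ ξ 1 0 - hop ζ ξ 0 1

lemma hop_congr {ζ ζ' ξ ξ' : Config} {x x' : ℤ} (h1 : ζ x = ζ' x) (h2 : ζ x' = ζ' x')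
    (h3 : ξ x = ξ' x) (h4 : ξ x' = ξ' x') : hop ζ ξ x x' = hop ζ' ξ' x x' := by
  simp [hop, h1, h2, h3, h4]

lemma hop_self (ζ : Config) (x x' : ℤ) : hop ζ ζ x x' = 0 := by
  unfold hop
  cases ζ x <;> simp

lemma crossing_self (ζ : Config) : crossing ζ ζ = 0 := by simp [crossing, hop_self]

lemma abs_crossing_le (ζ ξ : Config) : |crossing ζ ξ| ≤ 1 := by
  unfold crossing hop
  split_ifs <;> simp

lemma crossing_congr_left {ζ ζ' : Config} (h0 : ζ 0 = ζ' 0) (h1 : ζ 1 = ζ' 1) (ξ : Config) :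
    crossing ζ ξ = crossing ζ' ξ := by
  simp [crossing, hop, h0, h1]

lemma crossing_exchange (η : Config) (x : ℤ) :
    crossing η (exchange η x) = if x = 0 then occ η 1 - occ η 0 else 0 := by
  by_cases hx : x = 0
  · subst hx
    have h0 : exchange η 0 0 = η 1 := exchange_left η 0
    have h1 : exchange η 0 1 = η 0 := exchange_right η 0
    simp only [crossing, hop, occ, h0, h1]
    cases η 0 <;> cases η 1 <;> simp
  -- An exchange over any other bond leaves one of the sites `0`, `1` untouched, whereas a crossing
  -- alters both.
  · have : exchange η x 0 = η 0 ∨ exchange η x 1 = η 1 := by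
      by_cases h : x = 1
      · exact .inl (exchange_apply_of_ne (by omega) (by omega))
      · exact .inr (exchange_apply_of_ne (by omega) (by omega))
    simp only [crossing, hop, hx, if_false]
    rcases this with h | h <;> rw [h] <;> cases η 0 <;> cases η 1 <;> simp

/-! ### The current as a limit of sums of crossings over a grid -/

/-- The infimum of the failure set satisfies `P` by `hl`, and `hr` then keeps failures away from it.
The base case `t = 0` is the vacuous instance of `hl`. -/
lemma NNReal.real_induction {P : ℝ≥0 → Prop} (hl : ∀ t, (∀ s < t, P s) → P t)
    (hr : ∀ t, P t → ∃ u > t, ∀ s ∈ Set.Ioo t u, P s) (t : ℝ≥0) : P t := by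
  by_contra ht
  set S : Set ℝ≥0 := {s | ¬ P s}
  have hS : S.Nonempty := ⟨t, ht⟩
  have hlt : ∀ s < sInf S, P s := fun s hs => by
    by_contra h
    exact absurd (csInf_le (OrderBot.bddBelow S) h) (not_le.2 hs)
  have hP := hl _ hlt
  obtain ⟨u, hu, h⟩ := hr _ hP
  obtain ⟨s, hs, hsu⟩ := exists_lt_of_csInf_lt hS hu
  rcases (csInf_le (OrderBot.bddBelow S) hs).eq_or_lt with h' | h'
  · exact hs (h' ▸ hP)
  · exact hs (h s ⟨h', hsu⟩)

lemma le_ceil_div_mul {δ : ℝ≥0} (hδ : 0 < δ) (t : ℝ≥0) : t ≤ ⌈t / δ⌉₊ * δ :=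
  (div_le_iff₀ hδ).1 (Nat.le_ceil _)

lemma ceil_div_mul_lt {δ : ℝ≥0} (hδ : 0 < δ) (t : ℝ≥0) : ⌈t / δ⌉₊ * δ < t + δ := by
  have := mul_lt_mul_of_pos_right (Nat.ceil_lt_add_one (zero_le : 0 ≤ t / δ)) hδ
  rwa [add_mul, div_mul_cancel₀ _ hδ.ne', one_mul] at this

lemma mul_lt_of_lt_ceil_div {δ t : ℝ≥0} (hδ : 0 < δ) {i : ℕ} (hi : i < ⌈t / δ⌉₊) :
    i * δ < t :=
  (lt_div_iff₀ hδ).1 (Nat.lt_ceil.1 hi)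

lemma le_mul_of_ceil_div_le {δ t : ℝ≥0} (hδ : 0 < δ) {i : ℕ} (hi : ⌈t / δ⌉₊ ≤ i) :
    t ≤ i * δ :=
  (div_le_iff₀ hδ).1 (Nat.ceil_le.1 hi)

/-- Rounding up approaches `t` from the right, where right-continuity of the paths is available. -/
lemma tendsto_ceil_div_mul (t : ℝ≥0) :
    Tendsto (fun δ : ℝ≥0 => (⌈t / δ⌉₊ * δ : ℝ≥0)) (𝓝[>] 0) (𝓝[≥] t) := by
  refine tendsto_nhdsWithin_iff.2 ⟨?_, ?_⟩
  · refine tendsto_of_tendsto_of_tendsto_of_le_of_le' (g := fun _ => t) (h := fun δ => t + δ)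
      tendsto_const_nhds ?_ ?_ ?_
    · have : Tendsto (fun δ : ℝ≥0 => t + δ) (𝓝 0) (𝓝 (t + 0)) :=
        tendsto_const_nhds.add tendsto_id
      rw [add_zero] at this
      exact this.mono_left nhdsWithin_le_nhds
    · filter_upwards [self_mem_nhdsWithin] with δ hδ using le_ceil_div_mul hδ t
    · filter_upwards [self_mem_nhdsWithin] with δ hδ using (ceil_div_mul_lt hδ t).le
  · filter_upwards [self_mem_nhdsWithin] with δ hδ using le_ceil_div_mul hδ t

/-- The jumps from `x` to `x'` up to time `t` are finitely many, and they are all seen on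
a sufficiently fine grid. -/
def JumpsSeen (γ : ℝ≥0 → Config) (x x' : ℤ) (t : ℝ≥0) : Prop :=
  (jumpTimes γ x x' t).Finite ∧ ∀ᶠ δ : ℝ≥0 in 𝓝[>] 0,
    ∑ i ∈ Finset.range ⌈t / δ⌉₊, hop (γ (i * δ)) (γ ((i + 1 : ℕ) * δ)) x x' =
      ((jumpTimes γ x x' t).ncard : ℤ)

/-- The two occupations are frozen on `[s, t)`, so the only possible new jump time is `t` itself. -/
lemma jumpTimes_eq_union {γ : ℝ≥0 → Config} {x x' : ℤ} {s t : ℝ≥0} (hst : s < t)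
    (hconst : ∀ r ∈ Set.Ico s t, γ r x = γ s x ∧ γ r x' = γ s x') :
    jumpTimes γ x x' t = jumpTimes γ x x' s ∪
      {r | r = t ∧ γ s x = true ∧ γ s x' = false ∧ γ t x = false ∧ γ t x' = true} := by
  have hnear : ∀ r ∈ Set.Ioc s t, ∀ᶠ u in 𝓝[<] r, γ u x = γ s x ∧ γ u x' = γ s x' := by
    intro r hr
    filter_upwards [Ioo_mem_nhdsLT hr.1] with u hu
    exact hconst u ⟨hu.1.le, hu.2.trans_le hr.2⟩
  have hne : ∀ r ∈ Set.Ioc s t, (𝓝[<] r).NeBot := fun r hr => nhdsLT_neBot_of_exists_lt ⟨s, hr.1⟩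
  ext r
  constructor
  · rintro ⟨⟨h0, hrt⟩, hev, hx, hx'⟩
    by_cases hrs : r ≤ s
    · exact .inl ⟨⟨h0, hrs⟩, hev, hx, hx'⟩
    · right
      have hr : r ∈ Set.Ioc s t := ⟨not_le.1 hrs, hrt⟩
      have := hne r hr
      obtain ⟨u, ⟨h1, h2⟩, h3, h4⟩ := (hev.and (hnear r hr)).exists
      have hrt' : r = t := by
        by_contra h
        have := (hconst r ⟨hr.1.le, lt_of_le_of_ne hrt h⟩).1
        rw [hx, ← h3, h1] at this
        simp at this
      subst hrt'
      exact ⟨rfl, h3 ▸ h1, h4 ▸ h2, hx, hx'⟩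
  · rintro (⟨⟨h0, hrs⟩, h⟩ | ⟨rfl, h1, h2, h3, h4⟩)
    · exact ⟨⟨h0, hrs.trans hst.le⟩, h⟩
    · refine ⟨⟨zero_le.trans_lt hst, le_rfl⟩, ?_, h3, h4⟩
      filter_upwards [hnear r ⟨hst, le_rfl⟩] with u hu
      rw [hu.1, hu.2]
      exact ⟨h1, h2⟩

/-- Grid points in `[s, t)` see frozen occupations, so after the first grid point past `s` only the
step straddling `t` can contribute. For a fine mesh that step ends where the occupations are still
those at `t`. -/
lemma JumpsSeen.step {γ : ℝ≥0 → Config} {x x' : ℤ} {s t : ℝ≥0} (hs : JumpsSeen γ x x' s)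
    (hst : s < t) (hconst : ∀ r ∈ Set.Ico s t, γ r x = γ s x ∧ γ r x' = γ s x')
    (hright : ∀ᶠ r in 𝓝[≥] t, γ r x = γ t x ∧ γ r x' = γ t x') : JumpsSeen γ x x' t := by
  obtain ⟨hfin, hev⟩ := hs
  have hunion := jumpTimes_eq_union hst hconst
  set N := {r | r = t ∧ γ s x = true ∧ γ s x' = false ∧ γ t x = false ∧ γ t x' = true} with hN
  have hNfin : N.Finite := (Set.finite_singleton t).subset fun r hr => hr.1
  have hdisj : Disjoint (jumpTimes γ x x' s) N := by
    rw [Set.disjoint_left]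
    rintro r ⟨⟨-, hrs⟩, -⟩ ⟨rfl, -⟩
    exact absurd hrs (not_le.2 hst)
  have hNcard : (N.ncard : ℤ) = hop (γ s) (γ t) x x' := by
    unfold hop
    split_ifs with h
    · have : N = {t} := by ext r; simp [hN, h]
      simp [this]
    · have : N = ∅ := by ext r; simp only [hN, Set.mem_ofPred_eq, h, and_false]; simp
      simp [this]
  refine ⟨hunion ▸ hfin.union hNfin, ?_⟩
  -- A mesh below `t - s` puts at least one grid point in `[s, t)`.
  have hsmall : ∀ᶠ δ : ℝ≥0 in 𝓝[>] 0, δ < t - s :=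
    nhdsWithin_le_nhds (Iio_mem_nhds (tsub_pos_of_lt hst))
  filter_upwards [hev, self_mem_nhdsWithin, hsmall, (tendsto_ceil_div_mul t).eventually hright]
    with δ hδs (hδ : 0 < δ) hδst hδt
  rw [hunion, Set.ncard_union_eq hdisj hfin hNfin, Nat.cast_add, ← hδs, hNcard]
  have hlt : ⌈s / δ⌉₊ < ⌈t / δ⌉₊ := by
    rw [Nat.lt_ceil, lt_div_iff₀ hδ]
    exact (ceil_div_mul_lt hδ s).trans (lt_tsub_iff_left.1 hδst)
  obtain ⟨k, hk⟩ : ∃ k, ⌈t / δ⌉₊ = k + 1 := ⟨_, (Nat.sub_add_cancel (by omega)).symm⟩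
  have hgrid : ∀ i, ⌈s / δ⌉₊ ≤ i → i < ⌈t / δ⌉₊ → (i * δ : ℝ≥0) ∈ Set.Ico s t := fun i h1 h2 =>
    ⟨le_mul_of_ceil_div_le hδ h1, mul_lt_of_lt_ceil_div hδ h2⟩
  rw [← Finset.sum_range_add_sum_Ico _ hlt.le]
  congr 1
  rw [hk, Finset.sum_Ico_succ_top (by omega), Finset.sum_eq_zero, zero_add]
  · have h1 := hconst _ (hgrid k (by omega) (by omega))
    rw [hk] at hδt
    exact hop_congr h1.1 h1.2 hδt.1 hδt.2
  · intro i hi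
    rw [Finset.mem_Ico] at hi
    have h1 := hconst _ (hgrid i hi.1 (by omega))
    have h2 := hconst _ (hgrid (i + 1) (by omega) (by omega))
    rw [hop_congr h1.1 h1.2 h2.1 h2.2, hop_self]

/-- Occupations are discrete, so left limits freeze the pair on an interval just before `t` and
right-continuity freezes it just after. Real induction chains these intervals. -/
lemma jumpsSeen {γ : ℝ≥0 → Config}
    (hr : ∀ t, ContinuousWithinAt γ (Set.Ici t) t)
    (hl : ∀ t, ∃ ζ : Config, Tendsto γ (𝓝[<] t) (𝓝 ζ)) (x x' : ℤ) (t : ℝ≥0) :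
    JumpsSeen γ x x' t := by
  have key : ∀ {l : Filter ℝ≥0} {ζ : Config}, Tendsto γ l (𝓝 ζ) →
      ∀ᶠ r in l, γ r x = ζ x ∧ γ r x' = ζ x' := by
    intro l ζ h
    have h' : ∀ z, ∀ᶠ r in l, γ r z = ζ z := fun z => by
      have := tendsto_pi_nhds.1 h z
      rw [nhds_discrete, tendsto_pure] at this
      exact this
    exact (h' x).and (h' x')
  have hright : ∀ t, ∀ᶠ r in 𝓝[≥] t, γ r x = γ t x ∧ γ r x' = γ t x' := fun t => key (hr t)
  refine NNReal.real_induction (P := JumpsSeen γ x x') (fun t ih => ?_) (fun t ht => ?_) t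
  · rcases eq_zero_or_pos t with rfl | htpos
    · have : jumpTimes γ x x' 0 = ∅ := by
        ext s
        simp [jumpTimes]
      simp [JumpsSeen, this]
    · obtain ⟨ζ, hζ⟩ := hl t
      obtain ⟨l, hlt, hsub⟩ := (mem_nhdsLT_iff_exists_Ioo_subset' htpos).1 (key hζ)
      obtain ⟨s, hls, hst⟩ := exists_between (Set.mem_Iio.1 hlt)
      refine (ih s hst).step hst (fun r hr' => ?_) (hright t)
      have h1 := hsub (show r ∈ Set.Ioo l t from ⟨hls.trans_le hr'.1, hr'.2⟩)
      have h2 := hsub (show s ∈ Set.Ioo l t from ⟨hls, hst⟩)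
      exact ⟨h1.1.trans h2.1.symm, h1.2.trans h2.2.symm⟩
  · obtain ⟨u, hu, hsub⟩ := mem_nhdsGE_iff_exists_Ico_subset.1 (hright t)
    exact ⟨u, hu, fun s hs => ht.step hs.1
      (fun r hr' => hsub ⟨hr'.1, hr'.2.trans hs.2⟩) (hright s)⟩

/-- The net number of crossings of the bond `(0, 1)` seen along the first `k` steps of the grid
of mesh `δ`. -/
def gridCurrent (γ : ℝ≥0 → Config) (δ : ℝ≥0) (k : ℕ) : ℤ :=
  ∑ i ∈ Finset.range k, crossing (γ (i * δ)) (γ ((i + 1 : ℕ) * δ))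

lemma gridCurrent_succ (γ : ℝ≥0 → Config) (δ : ℝ≥0) (k : ℕ) :
    gridCurrent γ δ (k + 1) = gridCurrent γ δ k + crossing (γ (k * δ)) (γ ((k + 1 : ℕ) * δ)) :=
  Finset.sum_range_succ _ _

lemma eventually_gridCurrent_eq {γ : ℝ≥0 → Config}
    (hr : ∀ t, ContinuousWithinAt γ (Set.Ici t) t)
    (hl : ∀ t, ∃ ζ : Config, Tendsto γ (𝓝[<] t) (𝓝 ζ)) (t : ℝ≥0) :
    ∀ᶠ δ : ℝ≥0 in 𝓝[>] 0, gridCurrent γ δ ⌈t / δ⌉₊ = current γ 0 t := by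
  filter_upwards [(jumpsSeen hr hl 1 0 t).2, (jumpsSeen hr hl 0 1 t).2] with δ h1 h2
  simp only [gridCurrent, crossing, Finset.sum_sub_distrib, h1, h2, current, zero_add]

lemma abs_gridCurrent_le (γ : ℝ≥0 → Config) (δ : ℝ≥0) (k : ℕ) : |gridCurrent γ δ k| ≤ k := by
  refine (Finset.abs_sum_le_sum_abs _ _).trans ?_
  exact (Finset.sum_le_sum fun i _ => abs_crossing_le _ _).trans (by simp)

/-! ### Heights of a configuration -/

/-- The height `N(y, t) - Q(0, t)` as a function of the configuration at time `t`. -/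
def profile (η : Config) (y : ℤ) : ℤ :=
  if 0 < y then ∑ z ∈ Finset.Icc 1 y, occ η z else -∑ z ∈ Finset.Icc (y + 1) 0, occ η z

lemma height_eq (γ : ℝ≥0 → Config) (y : ℤ) (t : ℝ≥0) :
    height γ y t = current γ 0 t + profile (γ t) y := rfl

lemma profile_zero (η : Config) : profile η 0 = 0 := by simp [profile]

lemma profile_succ (η : Config) (y : ℤ) : profile η (y + 1) = profile η y + occ η (y + 1) := by
  unfold profile
  rcases lt_trichotomy y 0 with h | rfl | h
  · rw [if_neg (by omega), if_neg (by omega)]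
    have : Finset.Icc (y + 1) 0 = insert (y + 1) (Finset.Icc (y + 1 + 1) 0) := by
      ext z; simp only [Finset.mem_insert, Finset.mem_Icc]; omega
    rw [this, Finset.sum_insert (by simp)]
    ring
  · simp
  · rw [if_pos (by omega), if_pos h]
    have : Finset.Icc 1 (y + 1) = insert (y + 1) (Finset.Icc 1 y) := by
      ext z; simp only [Finset.mem_insert, Finset.mem_Icc]; omega
    rw [this, Finset.sum_insert (by simp)]
    ring

lemma occ_exchange (η : Config) (x z : ℤ) : occ (exchange η x) z =
    occ η z + ((if z = x then 1 else 0) - (if z = x + 1 then 1 else 0)) *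
      (occ η (x + 1) - occ η x) := by
  by_cases h1 : z = x
  · subst h1; simp [occ]
  · by_cases h2 : z = x + 1
    · subst h2; simp [occ]
    · simp [occ, exchange_apply_of_ne h1 h2, h1, h2]

/-- An exchange over the bond `(x, x + 1)` changes the height at `x` only. -/
lemma crossing_add_profile_exchange (η : Config) (x y : ℤ) :
    crossing η (exchange η x) + profile (exchange η x) y =
      profile η y + if y = x then occ η (x + 1) - occ η x else 0 := by
  -- The discrepancy does not depend on `y`, so it can be evaluated at `y = 0`, where the profile
  -- vanishes.
  have step : ∀ y, profile (exchange η x) (y + 1) - profile η (y + 1) -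
      (if y + 1 = x then occ η (x + 1) - occ η x else 0) =
      profile (exchange η x) y - profile η y -
      (if y = x then occ η (x + 1) - occ η x else 0) := fun y => by
    rw [profile_succ, profile_succ, occ_exchange]
    simp only [add_left_inj]
    split_ifs <;> ring
  have main : profile (exchange η x) y - profile η y -
      (if y = x then occ η (x + 1) - occ η x else 0) = -crossing η (exchange η x) := by
    induction y using Int.induction_on with
    | zero =>
      rw [crossing_exchange, profile_zero, profile_zero]
      by_cases hx : x = 0
      · subst hx; simp
      · simp [hx, Ne.symm hx]
    | succ i ih => rw [step, ih]
    | pred i ih => rw [← ih, ← step]; simp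
  linarith

lemma isCylinder_zpow_profile (r : ℝ) (m y : ℤ) :
    IsCylinder fun η => r ^ (m * profile η y) := by
  refine .intro (Finset.Icc 1 y ∪ Finset.Icc (y + 1) 0) fun η ξ h => ?_
  have : profile η y = profile ξ y := by
    unfold profile occ
    split_ifs
    · exact Finset.sum_congr rfl fun z hz => by rw [h z (Finset.mem_union_left _ hz)]
    · congr 1
      exact Finset.sum_congr rfl fun z hz => by rw [h z (Finset.mem_union_right _ hz)]
  simp only [this]

/-! ### Measurability and short-time expansions from the martingale problem -/

namespace IsASEP

variable {Ω : Type*} {mΩ : MeasurableSpace Ω} {μ : Measure Ω}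
  {ℱ : Filtration ℝ≥0 mΩ} {p q : ℝ} {η : ℝ≥0 → Ω → Config}

lemma measurable_cylinder (hη : IsASEP p q η ℱ μ) {f : Config → ℝ} (hf : IsCylinder f)
    (t : ℝ≥0) : Measurable[ℱ t] fun ω => f (η t ω) :=
  hf.measurable_comp (m := ℱ t) (hη.measurable t)

lemma measurable_cylinder' (hη : IsASEP p q η ℱ μ) {f : Config → ℝ} (hf : IsCylinder f)
    (t : ℝ≥0) : Measurable fun ω => f (η t ω) :=
  (hη.measurable_cylinder hf t).mono (ℱ.le t) le_rfl

/-- Right-continuity makes the process a limit of processes constant on grid cells. Joint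
measurability is needed for Fubini. -/
lemma measurable_uncurry (hη : IsASEP p q η ℱ μ) {f : Config → ℝ} (hf : IsCylinder f) :
    Measurable fun z : ℝ≥0 × Ω => f (η z.1 z.2) := by
  refine measurable_of_tendsto_metrizable' (𝓝[>] (0 : ℝ≥0))
    (f := fun δ z => f (η (⌈z.1 / δ⌉₊ * δ) z.2)) (fun δ => ?_) (tendsto_pi_nhds.2 fun z => ?_)
  · have h1 : Measurable fun y : ℕ × Ω => f (η (y.1 * δ) y.2) :=
      measurable_from_prod_countable_right fun n => hη.measurable_cylinder' hf (n * δ)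
    have h2 : Measurable fun z : ℝ≥0 × Ω => (⌈z.1 / δ⌉₊, z.2) :=
      (Nat.measurable_ceil.comp (measurable_fst.div_const δ)).prodMk measurable_snd
    exact h1.comp h2
  · have h := (hη.right_continuous z.2 z.1).tendsto
    exact tendsto_nhds_of_eventually_eq
      ((tendsto_ceil_div_mul z.1).eventually (hf.eventually_eq h))

lemma intervalIntegrable (hη : IsASEP p q η ℱ μ) {f : Config → ℝ} (hf : IsCylinder f) (ω : Ω)
    (a b : ℝ) : IntervalIntegrable (fun r : ℝ => f (η r.toNNReal ω)) volume a b := by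
  obtain ⟨C, -, hC⟩ := hf.exists_bound
  have : Measurable fun r : ℝ => f (η r.toNNReal ω) :=
    (hη.measurable_uncurry hf).comp (measurable_real_toNNReal.prodMk measurable_const)
  exact (intervalIntegrable_const (c := C)).mono_fun this.aestronglyMeasurable
    (ae_of_all _ fun r => by simpa using (hC _).trans (le_abs_self C))

lemma integrable_weight_mul (hη : IsASEP p q η ℱ μ) {f : Config → ℝ} (hf : IsCylinder f)
    {W : Ω → ℝ} (hW : Integrable W μ) (t : ℝ≥0) : Integrable (fun ω => W ω * f (η t ω)) μ := by
  obtain ⟨C, -, hC⟩ := hf.exists_bound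
  exact hW.mul_bdd (c := C) (hη.measurable_cylinder' hf t).aestronglyMeasurable
    (ae_of_all _ fun ω => by simpa using hC _)

lemma integrable_weight_mul_sub (hη : IsASEP p q η ℱ μ) {f : Config → ℝ} (hf : IsCylinder f)
    {W : Ω → ℝ} (hW : Integrable W μ) (s t : ℝ≥0) :
    Integrable (fun ω => W ω * (f (η t ω) - f (η s ω))) μ :=
  ((hη.integrable_weight_mul hf hW t).sub (hη.integrable_weight_mul hf hW s)).congr
    (ae_of_all _ fun _ => (mul_sub _ _ _).symm)

lemma integrable_weight_mul_intervalIntegral (hη : IsASEP p q η ℱ μ) {g : Config → ℝ}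
    (hg : IsCylinder g) {a b : ℝ} (hab : a ≤ b) {W : Ω → ℝ} (hW : Integrable W μ) :
    Integrable (fun ω => W ω * ∫ r in a..b, g (η r.toNNReal ω)) μ := by
  obtain ⟨D, -, hD⟩ := hg.exists_bound
  have hmeas : StronglyMeasurable fun ω => ∫ r in a..b, g (η r.toNNReal ω) := by
    simp only [intervalIntegral.integral_of_le hab]
    have : Measurable fun z : Ω × ℝ => g (η z.2.toNNReal z.1) :=
      (hη.measurable_uncurry hg).comp
        ((measurable_real_toNNReal.comp measurable_snd).prodMk measurable_fst)
    exact this.stronglyMeasurable.integral_prod_right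
  refine hW.mul_bdd (c := D * |b - a|) hmeas.aestronglyMeasurable (ae_of_all _ fun ω => ?_)
  exact intervalIntegral.norm_integral_le_of_norm_le_const fun r _ => hD _

variable [IsProbabilityMeasure μ]

/-- The martingale property tested against a bounded weight that is known at time `s`. -/
lemma integral_weight_mul_increment (hη : IsASEP p q η ℱ μ) {f : Config → ℝ}
    (hf : IsCylinder f) {s t : ℝ≥0} (hst : s ≤ t) {W : Ω → ℝ} (hWm : Measurable[ℱ s] W) {B : ℝ}
    (hWB : ∀ ω, |W ω| ≤ B) :
    ∫ ω, W ω * (f (η t ω) - f (η s ω)) ∂μ =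
      ∫ ω, W ω * (∫ r in (s : ℝ)..t, generator p q f (η r.toNNReal ω)) ∂μ := by
  set M : ℝ≥0 → Ω → ℝ := fun t ω =>
    f (η t ω) - ∫ r in (0 : ℝ)..(t : ℝ), generator p q f (η r.toNNReal ω) with hM
  have hmart : Martingale M ℱ μ := hη.martingale f hf
  have hWs : StronglyMeasurable[ℱ s] W := hWm.stronglyMeasurable
  have hbd : ∀ᵐ ω ∂μ, ‖W ω‖ ≤ B := ae_of_all _ hWB
  have hWM : ∀ u, Integrable (fun ω => W ω * M u ω) μ := fun u =>
    (hmart.integrable u).bdd_mul (c := B) (hWs.mono (ℱ.le s)).aestronglyMeasurable hbd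
  have hWi : Integrable W μ :=
    Integrable.of_bound (hWs.mono (ℱ.le s)).aestronglyMeasurable B hbd
  have key : ∫ ω, W ω * M t ω ∂μ = ∫ ω, W ω * M s ω ∂μ := by
    rw [← integral_condExp (ℱ.le s)]
    refine integral_congr_ae ?_
    filter_upwards [condExp_stronglyMeasurable_mul_of_bound (ℱ.le s) hWs (hmart.integrable t) B hbd,
      hmart.2 s t hst] with ω h1 h2
    rw [← h2]
    exact h1
  have hdiff : ∀ ω, W ω * (∫ r in (s : ℝ)..t, generator p q f (η r.toNNReal ω)) =
      W ω * (f (η t ω) - f (η s ω)) - (W ω * M t ω - W ω * M s ω) := fun ω => by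
    rw [← intervalIntegral.integral_interval_sub_left
      (hη.intervalIntegrable (hf.generator p q) ω 0 t)
      (hη.intervalIntegrable (hf.generator p q) ω 0 s)]
    simp only [hM]
    ring
  have hWf := hη.integrable_weight_mul_sub hf hWi s t
  have hWMM : Integrable (fun ω => W ω * M t ω - W ω * M s ω) μ := (hWM t).sub (hWM s)
  simp only [hdiff]
  rw [integral_sub hWf hWMM, integral_sub (hWM t) (hWM s), key, sub_self, sub_zero]

/-- The bound involves `∫ W` and not the supremum `B`: for the grid weights used later, `B` has no
control uniform in the number of steps, while `∫ W` can be propagated. -/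
lemma abs_integral_weight_mul_increment_le (hη : IsASEP p q η ℱ μ) {f : Config → ℝ}
    (hf : IsCylinder f) {C : ℝ} (hC : ∀ ξ, |generator p q f ξ| ≤ C) {s t : ℝ≥0} (hst : s ≤ t)
    {W : Ω → ℝ} (hWm : Measurable[ℱ s] W) {B : ℝ} (hWB : ∀ ω, |W ω| ≤ B) (hW0 : ∀ ω, 0 ≤ W ω) :
    |∫ ω, W ω * (f (η t ω) - f (η s ω)) ∂μ| ≤ C * (t - s) * ∫ ω, W ω ∂μ := by
  have hWi : Integrable W μ := Integrable.of_bound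
    (hWm.mono (ℱ.le s) le_rfl).aestronglyMeasurable B (ae_of_all _ hWB)
  rw [hη.integral_weight_mul_increment hf hst hWm hWB, ← integral_const_mul, ← Real.norm_eq_abs]
  refine norm_integral_le_of_norm_le (hWi.const_mul _) (ae_of_all _ fun ω => ?_)
  rw [norm_mul, Real.norm_of_nonneg (hW0 ω), mul_comm]
  refine mul_le_mul_of_nonneg_right ?_ (hW0 ω)
  have := intervalIntegral.norm_integral_le_of_norm_le_const (a := (s : ℝ)) (b := t)
    (f := fun r => generator p q f (η r.toNNReal ω)) (C := C) fun r _ => hC _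
  rwa [abs_of_nonneg (sub_nonneg.2 (by exact_mod_cast hst))] at this

lemma integral_weight_mul_intervalIntegral_sub (hη : IsASEP p q η ℱ μ) {g : Config → ℝ}
    (hg : IsCylinder g) {s t : ℝ≥0} (hst : s ≤ t) {W : Ω → ℝ} (hWm : Measurable W) {B : ℝ}
    (hWB : ∀ ω, |W ω| ≤ B) :
    ∫ ω, W ω * ((∫ r in (s : ℝ)..t, g (η r.toNNReal ω)) - (t - s) * g (η s ω)) ∂μ =
      ∫ r in (s : ℝ)..t, (∫ ω, W ω * (g (η r.toNNReal ω) - g (η s ω)) ∂μ) := by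
  have hst' : (s : ℝ) ≤ t := by exact_mod_cast hst
  have hI : ∀ ω, W ω * ((∫ r in (s : ℝ)..t, g (η r.toNNReal ω)) - (t - s) * g (η s ω)) =
      ∫ r in (s : ℝ)..t, W ω * (g (η r.toNNReal ω) - g (η s ω)) := fun ω => by
    rw [intervalIntegral.integral_const_mul, intervalIntegral.integral_sub
      (hη.intervalIntegrable hg ω _ _) intervalIntegrable_const, intervalIntegral.integral_const,
      smul_eq_mul]
  obtain ⟨D, hD0, hD⟩ := hg.exists_bound
  have hB0 : 0 ≤ B := (abs_nonneg _).trans (hWB (Classical.choice μ.nonempty_of_neZero))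
  rw [integral_congr_ae (ae_of_all _ hI)]
  simp only [intervalIntegral.integral_of_le hst']
  have hm : Measurable fun z : Ω × ℝ => W z.1 * (g (η z.2.toNNReal z.1) - g (η s z.1)) := by
    refine (hWm.comp measurable_fst).mul (Measurable.sub ?_ ?_)
    · exact (hη.measurable_uncurry hg).comp
        ((measurable_real_toNNReal.comp measurable_snd).prodMk measurable_fst)
    · exact (hη.measurable_cylinder' hg s).comp measurable_fst
  have hint : Integrable (fun z : Ω × ℝ => W z.1 * (g (η z.2.toNNReal z.1) - g (η s z.1)))
      (μ.prod (volume.restrict (Set.Ioc (s : ℝ) t))) := by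
    refine .of_bound hm.aestronglyMeasurable (B * (D + D)) (ae_of_all _ fun z => ?_)
    rw [Real.norm_eq_abs, abs_mul]
    exact mul_le_mul (hWB _) ((abs_sub _ _).trans (add_le_add (hD _) (hD _))) (abs_nonneg _) hB0
  exact integral_integral_swap hint

/-- The short-time expansion of a cylinder function, with a uniform quadratic error. -/
lemma abs_integral_weight_mul_expansion_le (hη : IsASEP p q η ℱ μ) {f : Config → ℝ}
    (hf : IsCylinder f) {C : ℝ} (hC : ∀ ξ, |generator p q (generator p q f) ξ| ≤ C) {s t : ℝ≥0}
    (hst : s ≤ t) {W : Ω → ℝ} (hWm : Measurable[ℱ s] W) {B : ℝ} (hWB : ∀ ω, |W ω| ≤ B)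
    (hW0 : ∀ ω, 0 ≤ W ω) :
    |∫ ω, W ω * (f (η t ω) - f (η s ω) - (t - s) * generator p q f (η s ω)) ∂μ| ≤
      C * (t - s) ^ 2 * ∫ ω, W ω ∂μ := by
  have hg := hf.generator p q
  have hWm' : Measurable W := hWm.mono (ℱ.le s) le_rfl
  have hWi : Integrable W μ := Integrable.of_bound hWm'.aestronglyMeasurable B (ae_of_all _ hWB)
  have hst' : (s : ℝ) ≤ t := by exact_mod_cast hst
  have hWI := hη.integrable_weight_mul_intervalIntegral hg hst' hWi
  have hWf := hη.integrable_weight_mul_sub hf hWi s t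
  have hWg : Integrable (fun ω => W ω * (((t : ℝ) - s) * generator p q f (η s ω))) μ :=
    ((hη.integrable_weight_mul hg hWi s).const_mul ((t : ℝ) - s)).congr
      (ae_of_all _ fun ω => mul_left_comm _ _ _)
  have hswap := hη.integral_weight_mul_intervalIntegral_sub hg hst hWm' hWB
  have e1 : ∫ ω, W ω * (f (η t ω) - f (η s ω) - (t - s) * generator p q f (η s ω)) ∂μ =
      ∫ ω, W ω * ((∫ r in (s : ℝ)..t, generator p q f (η r.toNNReal ω)) -
        (t - s) * generator p q f (η s ω)) ∂μ := by
    simp only [mul_sub (W _) _ (((t : ℝ) - s) * _)]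
    rw [integral_sub hWf hWg, integral_sub hWI hWg,
      hη.integral_weight_mul_increment hf hst hWm hWB]
  rw [e1, hswap, ← Real.norm_eq_abs]
  have hWint : 0 ≤ ∫ ω, W ω ∂μ := integral_nonneg hW0
  have hC0 : 0 ≤ C := (abs_nonneg _).trans (hC fun _ => false)
  -- Second use of the martingale problem: the generator of `f` is itself a cylinder function, so
  -- its increments are of order `t - s`.
  have := intervalIntegral.norm_integral_le_of_norm_le_const (a := (s : ℝ)) (b := t)
    (f := fun r => ∫ ω, W ω * (generator p q f (η r.toNNReal ω) - generator p q f (η s ω)) ∂μ)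
    (C := C * (t - s) * ∫ ω, W ω ∂μ) fun r hr => by
      rw [Set.uIoc_of_le hst'] at hr
      have hsr : s ≤ r.toNNReal := NNReal.le_toNNReal_of_coe_le hr.1.le
      refine (hη.abs_integral_weight_mul_increment_le hg hC hsr hWm hWB hW0).trans ?_
      rw [Real.coe_toNNReal _ (s.2.trans hr.1.le)]
      gcongr
      exact hr.2
  rw [abs_of_nonneg (sub_nonneg.2 hst')] at this
  exact this.trans_eq (by ring)

end IsASEP

/-! ### The generator tilted by the crossings of the bond `(0, 1)` -/

/-- The function `g`, weighted by `ρ ^ m` for each crossing in the transition from `ζ` to `ξ`. -/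
def tilt (ρ : ℝ) (m : ℤ) (g : Config → ℝ) (ζ ξ : Config) : ℝ := ρ ^ (m * crossing ζ ξ) * g ξ

/-- The generator of the ASEP in which every crossing of the bond `(0, 1)` is weighted
by `ρ ^ m`. -/
def tiltedGenerator (p q ρ : ℝ) (m : ℤ) (g : Config → ℝ) (η : Config) : ℝ :=
  generator p q (tilt ρ m g η) η

/-- A configuration with prescribed occupations of the sites `0` and `1`. -/
def pattern (a : Bool × Bool) : Config := fun x => if x = 0 then a.1 else a.2

/-- The indicator that the sites `0` and `1` are occupied as prescribed. -/
def patternInd (a : Bool × Bool) (η : Config) : ℝ := if η 0 = a.1 ∧ η 1 = a.2 then 1 else 0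

lemma patternInd_nonneg (a : Bool × Bool) (η : Config) : 0 ≤ patternInd a η := by
  unfold patternInd
  split_ifs <;> norm_num

lemma patternInd_le_one (a : Bool × Bool) (η : Config) : patternInd a η ≤ 1 := by
  unfold patternInd
  split_ifs <;> norm_num

lemma isCylinder_patternInd (a : Bool × Bool) : IsCylinder (patternInd a) := by
  refine .intro {0, 1} fun η ξ h => ?_
  simp [patternInd, h 0 (by simp), h 1 (by simp)]

/-- The tilt depends on the random starting configuration, but the martingale problem needs a fixed
test function. Splitting over the four patterns yields fixed test functions, weighted by indicators
known at the starting time. -/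
lemma sum_patternInd_mul (η : Config) (F : Config → ℝ)
    (hF : F (pattern (η 0, η 1)) = F η) : ∑ a, patternInd a η * F (pattern a) = F η := by
  rw [Finset.sum_eq_single (η 0, η 1), hF]
  · simp [patternInd]
  · rintro ⟨a, b⟩ - hab
    have : ¬ (η 0 = a ∧ η 1 = b) := fun h => hab (by rw [h.1, h.2])
    simp [patternInd, this]
  · simp

lemma tilt_pattern (ρ : ℝ) (m : ℤ) (g : Config → ℝ) (η : Config) :
    tilt ρ m g (pattern (η 0, η 1)) = tilt ρ m g η := by
  ext ξ
  simp only [tilt]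
  rw [crossing_congr_left (ζ := pattern (η 0, η 1)) (ζ' := η) (by simp [pattern])
    (by simp [pattern])]

lemma tilt_self (ρ : ℝ) (m : ℤ) (g : Config → ℝ) (η : Config) : tilt ρ m g η η = g η := by
  simp [tilt, crossing_self]

lemma isCylinder_tilt (ρ : ℝ) (m : ℤ) {g : Config → ℝ} (hg : IsCylinder g) (ζ : Config) :
    IsCylinder (tilt ρ m g ζ) := by
  refine IsCylinder.mul (.intro {0, 1} fun η ξ h => ?_) hg
  simp only [crossing, hop, h 0 (by simp), h 1 (by simp)]

lemma isCylinder_tiltedGenerator (p q ρ : ℝ) (m : ℤ) {g : Config → ℝ} (hg : IsCylinder g) :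
    IsCylinder (tiltedGenerator p q ρ m g) := by
  have : tiltedGenerator p q ρ m g =
      fun η => ∑ a, patternInd a η * generator p q (tilt ρ m g (pattern a)) η := by
    ext η
    rw [sum_patternInd_mul η fun ζ => generator p q (tilt ρ m g ζ) η]
    · rfl
    · simp only [tilt_pattern]
  rw [this]
  exact .sum _ fun a _ => (isCylinder_patternInd a).mul ((isCylinder_tilt ρ m hg _).generator p q)

/-! ### Convergence of expectations under a second moment bound -/

/-- Fatou bounds the second moment of `Y`. The truncated difference tends to zero by dominated
convergence, and where `|X - Y| ≥ R` one has `|X - Y| ≤ |X - Y|² / R ≤ 2 (X² + Y²) / R`. -/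
lemma integrable_and_tendsto_integral_of_sq_bounded {Ω ι : Type*} {mΩ : MeasurableSpace Ω}
    {μ : Measure Ω} [IsFiniteMeasure μ] {l : Filter ι} [l.NeBot] [l.IsCountablyGenerated]
    {X : ι → Ω → ℝ} {Y : Ω → ℝ} {K : ℝ} (hX : ∀ i, Measurable (X i))
    (hXi : ∀ i, Integrable (fun ω => X i ω ^ 2) μ)
    (hK : ∀ᶠ i in l, ∫ ω, X i ω ^ 2 ∂μ ≤ K) (hlim : ∀ ω, Tendsto (fun i => X i ω) l (𝓝 (Y ω))) :
    Integrable Y μ ∧ Tendsto (fun i => ∫ ω, X i ω ∂μ) l (𝓝 (∫ ω, Y ω ∂μ)) := by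
  have hY : Measurable Y := measurable_of_tendsto_metrizable' l hX (tendsto_pi_nhds.2 hlim)
  have hnorm : ∀ {Z : Ω → ℝ}, Integrable (fun ω => Z ω ^ 2) μ →
      eLpNorm (fun ω => Z ω ^ 2) 1 μ = ENNReal.ofReal (∫ ω, Z ω ^ 2 ∂μ) := fun {Z} hZ => by
    rw [eLpNorm_one_eq_lintegral_enorm, ← ofReal_integral_norm_eq_lintegral_enorm hZ]
    simp
  have hle : eLpNorm (fun ω => Y ω ^ 2) 1 μ ≤ ENNReal.ofReal K := by
    refine Lp.eLpNorm_le_of_ae_tendsto (u := l) (f := fun i ω => X i ω ^ 2) ?_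
      (fun i => ((hX i).pow_const 2).aestronglyMeasurable) (ae_of_all _ fun ω => (hlim ω).pow 2)
    filter_upwards [hK] with i hi
    rw [hnorm (hXi i)]
    exact ENNReal.ofReal_le_ofReal hi
  have hY2 : Integrable (fun ω => Y ω ^ 2) μ := memLp_one_iff_integrable.1
    ⟨(hY.pow_const 2).aestronglyMeasurable, hle.trans_lt ENNReal.ofReal_lt_top⟩
  have hK0 : 0 ≤ K := by
    obtain ⟨i, hi⟩ := hK.exists
    exact (integral_nonneg fun ω => sq_nonneg _).trans hi
  have hYK : ∫ ω, Y ω ^ 2 ∂μ ≤ K := by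
    rw [hnorm hY2] at hle
    exact (ENNReal.ofReal_le_ofReal_iff hK0).1 hle
  have hint : ∀ {Z : Ω → ℝ}, Measurable Z → Integrable (fun ω => Z ω ^ 2) μ → Integrable Z μ :=
    fun hZ hZ2 =>
      ((memLp_two_iff_integrable_sq hZ.aestronglyMeasurable).2 hZ2).integrable one_le_two
  have hYi := hint hY hY2
  refine ⟨hYi, Metric.tendsto_nhds.2 fun ε hε => ?_⟩
  obtain ⟨R, hR, hRε⟩ : ∃ R : ℝ, 0 < R ∧ 4 * K / R ≤ ε / 2 := by
    -- The summand `1` keeps `R` positive when `K = 0`.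
    refine ⟨(8 * K + 1) / ε, by positivity, ?_⟩
    rw [div_div_eq_mul_div, div_le_div_iff₀ (by positivity) (by positivity)]
    nlinarith
  have htrunc : Tendsto (fun i => ∫ ω, min |X i ω - Y ω| R ∂μ) l (𝓝 0) := by
    have := tendsto_integral_filter_of_dominated_convergence (μ := μ) (l := l)
      (F := fun i ω => min |X i ω - Y ω| R) (f := fun _ => 0) (fun _ => R)
      (.of_forall fun i => (((hX i).sub hY).abs.min measurable_const).aestronglyMeasurable)
      (.of_forall fun i => ae_of_all _ fun ω => by
        rw [Real.norm_of_nonneg (le_min (abs_nonneg _) hR.le)]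
        exact min_le_right _ _)
      (integrable_const R)
      (ae_of_all _ fun ω => by
        have h : Tendsto (fun i => min |X i ω - Y ω| R) l (𝓝 (min |Y ω - Y ω| R)) :=
          (((hlim ω).sub_const _).abs).min tendsto_const_nhds
        rwa [sub_self, abs_zero, min_eq_left hR.le] at h)
    simpa using this
  filter_upwards [hK, htrunc.eventually (gt_mem_nhds (half_pos hε))] with i hi htr
  have hXii := hint (hX i) (hXi i)
  have hmin : Integrable (fun ω => min |X i ω - Y ω| R) μ :=
    Integrable.of_bound (((hX i).sub hY).abs.min measurable_const).aestronglyMeasurable R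
      (ae_of_all _ fun ω => by
        rw [Real.norm_of_nonneg (le_min (abs_nonneg _) hR.le)]
        exact min_le_right _ _)
  have hsq : Integrable (fun ω => 2 / R * (X i ω ^ 2 + Y ω ^ 2)) μ := ((hXi i).add hY2).const_mul _
  rw [Real.dist_eq, ← integral_sub hXii hYi]
  calc |∫ ω, (X i ω - Y ω) ∂μ| ≤ ∫ ω, (min |X i ω - Y ω| R + 2 / R * (X i ω ^ 2 + Y ω ^ 2)) ∂μ := by
        rw [← Real.norm_eq_abs]
        refine norm_integral_le_of_norm_le (hmin.add hsq) (ae_of_all _ fun ω => ?_)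
        rw [Real.norm_eq_abs]
        have hpos : 0 ≤ 2 / R * (X i ω ^ 2 + Y ω ^ 2) := by positivity
        rcases le_total |X i ω - Y ω| R with h | h
        · rw [min_eq_left h]
          linarith
        · have h1 : |X i ω - Y ω| * R ≤ |X i ω - Y ω| ^ 2 := by
            rw [sq]
            exact mul_le_mul_of_nonneg_left h (abs_nonneg _)
          rw [sq_abs] at h1
          have h2 : |X i ω - Y ω| ≤ 2 / R * (X i ω ^ 2 + Y ω ^ 2) := by
            rw [div_mul_eq_mul_div, le_div_iff₀ hR]
            nlinarith [sq_nonneg (X i ω + Y ω)]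
          exact h2.trans (le_add_of_nonneg_left (le_min (abs_nonneg _) hR.le))
    _ = ∫ ω, min |X i ω - Y ω| R ∂μ + 2 / R * (∫ ω, X i ω ^ 2 ∂μ + ∫ ω, Y ω ^ 2 ∂μ) := by
        rw [integral_add hmin hsq, integral_const_mul, integral_add (hXi i) hY2]
    _ ≤ ∫ ω, min |X i ω - Y ω| R ∂μ + 4 * K / R := by
        have : 2 / R * (∫ ω, X i ω ^ 2 ∂μ + ∫ ω, Y ω ^ 2 ∂μ) ≤ 2 / R * (K + K) := by gcongr
        exact (add_le_add_iff_left _).2 (this.trans_eq (by ring))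
    _ < ε := by linarith

/-! ### Exponential moments along a grid -/

/-- The weight `ρ ^ (m Q)`, where `Q` is the net number of crossings seen along a grid. -/
def gridWeight {Ω : Type*} (η : ℝ≥0 → Ω → Config) (ρ : ℝ) (m : ℤ) (δ : ℝ≥0) (k : ℕ) (ω : Ω) : ℝ :=
  ρ ^ (m * gridCurrent (fun s => η s ω) δ k)

/-- The expectation of `ρ ^ (m Q) g(η)` after `k` steps of the grid of mesh `δ`. -/
def gridMoment {Ω : Type*} {mΩ : MeasurableSpace Ω} (μ : Measure Ω) (η : ℝ≥0 → Ω → Config)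
    (ρ : ℝ) (m : ℤ) (δ : ℝ≥0) (g : Config → ℝ) (k : ℕ) : ℝ :=
  ∫ ω, gridWeight η ρ m δ k ω * g (η (k * δ) ω) ∂μ

lemma gridWeight_pos {Ω : Type*} (η : ℝ≥0 → Ω → Config) {ρ : ℝ} (hρ : 0 < ρ) (m : ℤ) (δ : ℝ≥0)
    (k : ℕ) (ω : Ω) : 0 < gridWeight η ρ m δ k ω := zpow_pos hρ _

lemma gridWeight_succ_mul {Ω : Type*} (η : ℝ≥0 → Ω → Config) {ρ : ℝ} (hρ : 0 < ρ) (m : ℤ)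
    (δ : ℝ≥0) (k : ℕ) (ω : Ω) (g : Config → ℝ) :
    gridWeight η ρ m δ (k + 1) ω * g (η ((k + 1 : ℕ) * δ) ω) =
      gridWeight η ρ m δ k ω * tilt ρ m g (η (k * δ) ω) (η ((k + 1 : ℕ) * δ) ω) := by
  simp only [gridWeight, tilt, gridCurrent_succ, mul_add, zpow_add₀ hρ.ne', mul_assoc]

lemma exists_gridWeight_le {Ω : Type*} (η : ℝ≥0 → Ω → Config) {ρ : ℝ} (hρ : 0 < ρ) (m : ℤ)
    (δ : ℝ≥0) (k : ℕ) : ∃ B, ∀ ω, gridWeight η ρ m δ k ω ≤ B := by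
  refine ⟨∑ j ∈ Finset.Icc (-(k : ℤ)) k, ρ ^ (m * j), fun ω => ?_⟩
  have h := abs_le.1 (abs_gridCurrent_le (fun s => η s ω) δ k)
  exact Finset.single_le_sum (f := fun j => ρ ^ (m * j)) (fun j _ => (zpow_pos hρ _).le)
    (Finset.mem_Icc.2 h)

namespace IsASEP

variable {Ω : Type*} {mΩ : MeasurableSpace Ω} {μ : Measure Ω}
  {ℱ : Filtration ℝ≥0 mΩ} {p q : ℝ} {η : ℝ≥0 → Ω → Config}

lemma measurable_gridWeight (hη : IsASEP p q η ℱ μ) (ρ : ℝ) (m : ℤ) (δ : ℝ≥0) (k : ℕ) :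
    Measurable[ℱ (k * δ)] (gridWeight η ρ m δ k) := by
  have hhop : ∀ x x', ∀ i < k,
      Measurable[ℱ (k * δ)] fun ω => hop (η (i * δ) ω) (η ((i + 1 : ℕ) * δ) ω) x x' := by
    intro x x' i hi
    have h : ∀ j ≤ k, ∀ z, Measurable[ℱ (k * δ)] fun ω => η (j * δ) ω z := fun j hj z =>
      (hη.measurable (j * δ) z).mono (ℱ.mono (by gcongr)) le_rfl
    have hF : Measurable fun b : (Bool × Bool) × (Bool × Bool) =>
        if b.1.1 = true ∧ b.1.2 = false ∧ b.2.1 = false ∧ b.2.2 = true then (1 : ℤ) else 0 :=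
      measurable_of_finite _
    exact hF.comp (((h i hi.le x).prodMk (h i hi.le x')).prodMk
      ((h (i + 1) hi x).prodMk (h (i + 1) hi x')))
  have : Measurable[ℱ (k * δ)] fun ω => gridCurrent (fun s => η s ω) δ k :=
    Finset.measurable_fun_sum _ fun i hi =>
      (hhop 1 0 i (Finset.mem_range.1 hi)).sub (hhop 0 1 i (Finset.mem_range.1 hi))
  exact (measurable_of_countable fun j : ℤ => ρ ^ (m * j)).comp this

lemma gridMoment_one_nonneg {ρ : ℝ} (hρ : 0 < ρ) (m : ℤ) (δ : ℝ≥0) (k : ℕ) :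
    0 ≤ gridMoment μ η ρ m δ (fun _ => 1) k :=
  integral_nonneg fun ω => by simpa using (gridWeight_pos η hρ m δ k ω).le

variable [IsProbabilityMeasure μ]

lemma integrable_gridWeight (hη : IsASEP p q η ℱ μ) {ρ : ℝ} (hρ : 0 < ρ) (m : ℤ) (δ : ℝ≥0)
    (k : ℕ) : Integrable (gridWeight η ρ m δ k) μ := by
  obtain ⟨B, hB⟩ := exists_gridWeight_le η hρ m δ k
  refine .of_bound ((hη.measurable_gridWeight ρ m δ k).mono (ℱ.le _) le_rfl).aestronglyMeasurable B
    (ae_of_all _ fun ω => ?_)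
  rw [Real.norm_of_nonneg (gridWeight_pos η hρ m δ k ω).le]
  exact hB ω

lemma abs_gridMoment_le (hη : IsASEP p q η ℱ μ) {ρ : ℝ} (hρ : 0 < ρ) (m : ℤ) (δ : ℝ≥0)
    {g : Config → ℝ} {D : ℝ} (hD : ∀ ξ, |g ξ| ≤ D) (k : ℕ) :
    |gridMoment μ η ρ m δ g k| ≤ D * gridMoment μ η ρ m δ (fun _ => 1) k := by
  simp only [gridMoment, mul_one]
  rw [← integral_const_mul, ← Real.norm_eq_abs]
  refine norm_integral_le_of_norm_le ((hη.integrable_gridWeight hρ m δ k).const_mul D)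
    (ae_of_all _ fun ω => ?_)
  rw [norm_mul, Real.norm_of_nonneg (gridWeight_pos η hρ m δ k ω).le, mul_comm]
  exact mul_le_mul_of_nonneg_right (hD _) (gridWeight_pos η hρ m δ k ω).le

/-- One step of the grid changes the moments according to the tilted generator. -/
lemma exists_abs_gridMoment_succ_sub_le (hη : IsASEP p q η ℱ μ) {ρ : ℝ} (hρ : 0 < ρ) (m : ℤ)
    {g : Config → ℝ} (hg : IsCylinder g) : ∃ C, 0 ≤ C ∧ ∀ (δ : ℝ≥0) (k : ℕ),
      |gridMoment μ η ρ m δ g (k + 1) - gridMoment μ η ρ m δ g k -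
        δ * gridMoment μ η ρ m δ (tiltedGenerator p q ρ m g) k| ≤
      C * (δ : ℝ) ^ 2 * gridMoment μ η ρ m δ (fun _ => 1) k := by
  have hf := fun a => isCylinder_tilt ρ m hg (pattern a)
  choose C hC0 hC using fun a => (((hf a).generator p q).generator p q).exists_bound
  refine ⟨∑ a, C a, Finset.sum_nonneg fun a _ => hC0 a, fun δ k => ?_⟩
  set s : ℝ≥0 := k * δ with hs
  set t : ℝ≥0 := (k + 1 : ℕ) * δ with ht
  have hst : s ≤ t := by rw [hs, ht]; gcongr; omega
  have htsub : (t : ℝ) - s = δ := by rw [hs, ht]; push_cast; ring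
  set V := gridWeight η ρ m δ k with hV
  have hVm : Measurable[ℱ s] V := hη.measurable_gridWeight ρ m δ k
  have hVi : Integrable V μ := hη.integrable_gridWeight hρ m δ k
  have hV0 : ∀ ω, 0 ≤ V ω := fun ω => (gridWeight_pos η hρ m δ k ω).le
  obtain ⟨B, hB⟩ := exists_gridWeight_le η hρ m δ k
  set W : Bool × Bool → Ω → ℝ := fun a ω => V ω * patternInd a (η s ω) with hW
  have hW0 : ∀ a ω, 0 ≤ W a ω := fun a ω => mul_nonneg (hV0 ω) (patternInd_nonneg _ _)
  have hWV : ∀ a ω, W a ω ≤ V ω := fun a ω =>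
    mul_le_of_le_one_right (hV0 ω) (patternInd_le_one _ _)
  have hWm : ∀ a, Measurable[ℱ s] (W a) := fun a =>
    hVm.mul (hη.measurable_cylinder (isCylinder_patternInd a) s)
  have hWi : ∀ a, Integrable (W a) μ := fun a =>
    hη.integrable_weight_mul (isCylinder_patternInd a) hVi s
  have hterm : ∀ a, Integrable (fun ω => W a ω * (tilt ρ m g (pattern a) (η t ω) -
      tilt ρ m g (pattern a) (η s ω) -
        (t - s) * generator p q (tilt ρ m g (pattern a)) (η s ω))) μ := fun a => by
    refine ((hη.integrable_weight_mul_sub (hf a) (hWi a) s t).sub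
      ((hη.integrable_weight_mul ((hf a).generator p q) (hWi a) s).const_mul ((t : ℝ) - s))).congr
      (ae_of_all _ fun ω => ?_)
    simp only [Pi.sub_apply]
    ring
  -- For each starting pattern the tilt at time `s` is just `g`, because no crossing has yet
  -- occurred in this step.
  have hdecomp : gridMoment μ η ρ m δ g (k + 1) - gridMoment μ η ρ m δ g k -
      δ * gridMoment μ η ρ m δ (tiltedGenerator p q ρ m g) k =
      ∑ a, ∫ ω, W a ω * (tilt ρ m g (pattern a) (η t ω) - tilt ρ m g (pattern a) (η s ω) -
        (t - s) * generator p q (tilt ρ m g (pattern a)) (η s ω)) ∂μ := by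
    have h1 : Integrable (fun ω => gridWeight η ρ m δ (k + 1) ω * g (η t ω)) μ :=
      hη.integrable_weight_mul hg (hη.integrable_gridWeight hρ m δ (k + 1)) t
    have h2 : Integrable (fun ω => V ω * g (η s ω)) μ := hη.integrable_weight_mul hg hVi s
    have h3 : Integrable (fun ω => δ * (V ω * tiltedGenerator p q ρ m g (η s ω))) μ :=
      (hη.integrable_weight_mul (isCylinder_tiltedGenerator p q ρ m hg) hVi s).const_mul _
    have h12 : Integrable (fun ω => gridWeight η ρ m δ (k + 1) ω * g (η t ω) -
      V ω * g (η s ω)) μ := h1.sub h2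
    rw [← integral_finsetSum _ fun a _ => hterm a]
    simp only [gridMoment]
    rw [← integral_const_mul, ← integral_sub h1 h2, ← integral_sub h12 h3]
    refine integral_congr_ae (ae_of_all _ fun ω => ?_)
    simp only [hW, mul_assoc, ← Finset.mul_sum]
    rw [sum_patternInd_mul (η s ω) fun ζ => tilt ρ m g ζ (η t ω) - tilt ρ m g ζ (η s ω) -
      (t - s) * generator p q (tilt ρ m g ζ) (η s ω)]
    · rw [gridWeight_succ_mul η hρ, tilt_self, htsub]
      simp only [tiltedGenerator]
      ring
    · simp only [tilt_pattern]
  rw [hdecomp]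
  refine (Finset.abs_sum_le_sum_abs _ _).trans ?_
  rw [Finset.sum_mul, Finset.sum_mul]
  refine Finset.sum_le_sum fun a _ => ?_
  refine (hη.abs_integral_weight_mul_expansion_le (hf a) (hC a) hst (hWm a)
    (B := B) (fun ω => ?_) (hW0 a)).trans ?_
  · rw [abs_of_nonneg (hW0 a ω)]
    exact (hWV a ω).trans (hB ω)
  · rw [htsub]
    refine mul_le_mul_of_nonneg_left ?_ (mul_nonneg (hC0 a) (sq_nonneg _))
    simp only [gridMoment, mul_one]
    exact integral_mono (hWi a) hVi (hWV a)

/-- Exponential moments of the current are bounded uniformly over the grids. -/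
lemma exists_gridMoment_one_le (hη : IsASEP p q η ℱ μ) {ρ : ℝ} (hρ : 0 < ρ) (m : ℤ) (T : ℝ) :
    ∃ B, 0 ≤ B ∧ ∀ (δ : ℝ≥0) (k : ℕ), δ ≤ 1 → k * (δ : ℝ) ≤ T →
      gridMoment μ η ρ m δ (fun _ => 1) k ≤ B := by
  obtain ⟨C, hC0, hC⟩ := hη.exists_abs_gridMoment_succ_sub_le hρ m (IsCylinder.const 1)
  obtain ⟨D, hD0, hD⟩ := (isCylinder_tiltedGenerator p q ρ m (IsCylinder.const 1)).exists_bound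
  refine ⟨Real.exp ((D + C) * T), (Real.exp_pos _).le, fun δ k hδ hk => ?_⟩
  have hδ' : (δ : ℝ) ≤ 1 := by exact_mod_cast hδ
  -- Discrete Gronwall: since `δ² ≤ δ`, one step multiplies the moment by at most `1 + (D + C) δ ≤
  -- exp ((D + C) δ)`.
  have main : gridMoment μ η ρ m δ (fun _ => 1) k ≤ Real.exp ((D + C) * δ) ^ k := by
    clear hk
    induction k with
    | zero => simp [gridMoment, gridWeight, gridCurrent]
    | succ k ih =>
      have h1 := (abs_le.1 (hC δ k)).2
      have h2 := (abs_le.1 (hη.abs_gridMoment_le hρ m δ hD k)).2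
      have hV := gridMoment_one_nonneg (μ := μ) (η := η) hρ m δ k
      set V := gridMoment μ η ρ m δ (fun _ => 1) k
      have h3 : C * (δ : ℝ) ^ 2 * V ≤ C * δ * V := by
        have : (δ : ℝ) ^ 2 ≤ δ := by rw [sq]; exact mul_le_of_le_one_left δ.coe_nonneg hδ'
        gcongr
      have h4 := mul_le_mul_of_nonneg_left h2 δ.coe_nonneg
      have h5 : gridMoment μ η ρ m δ (fun _ => 1) (k + 1) ≤ ((D + C) * δ + 1) * V := by
        linarith
      refine h5.trans ?_
      rw [pow_succ']
      exact mul_le_mul (Real.add_one_le_exp _) ih hV (Real.exp_pos _).le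
  refine main.trans ?_
  rw [← Real.exp_nat_mul]
  refine Real.exp_le_exp.2 ?_
  calc (k : ℝ) * ((D + C) * δ) = (D + C) * (k * δ) := by ring
    _ ≤ (D + C) * T := by gcongr

lemma exists_abs_gridMoment_add_sub_le (hη : IsASEP p q η ℱ μ) {ρ : ℝ} (hρ : 0 < ρ) (m : ℤ)
    {g : Config → ℝ} (hg : IsCylinder g) (T : ℝ) : ∃ C, 0 ≤ C ∧ ∀ (δ : ℝ≥0) (k j : ℕ), δ ≤ 1 →
      ((k + j : ℕ) : ℝ) * δ ≤ T →
      |gridMoment μ η ρ m δ g (k + j) - gridMoment μ η ρ m δ g k| ≤ C * (j * δ) := by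
  obtain ⟨B, hB0, hB⟩ := hη.exists_gridMoment_one_le hρ m T
  obtain ⟨C, hC0, hC⟩ := hη.exists_abs_gridMoment_succ_sub_le hρ m hg
  obtain ⟨D, hD0, hD⟩ := (isCylinder_tiltedGenerator p q ρ m hg).exists_bound
  refine ⟨(D + C) * B, by positivity, fun δ k j hδ hT => ?_⟩
  have hδ' : (δ : ℝ) ≤ 1 := by exact_mod_cast hδ
  induction j with
  | zero => simp
  | succ j ih =>
    have hT' : ((k + j : ℕ) : ℝ) * δ ≤ T := by
      refine le_trans ?_ hT
      gcongr
      omega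
    have h1 := hC δ (k + j)
    have h2 := hη.abs_gridMoment_le hρ m δ hD (k + j)
    have hV := gridMoment_one_nonneg (μ := μ) (η := η) hρ m δ (k + j)
    have hVB := hB δ (k + j) hδ hT'
    set V := gridMoment μ η ρ m δ (fun _ => 1) (k + j)
    set u := gridMoment μ η ρ m δ (tiltedGenerator p q ρ m g) (k + j)
    have h3 : C * (δ : ℝ) ^ 2 * V ≤ C * δ * B := by
      have : (δ : ℝ) ^ 2 ≤ δ := by rw [sq]; exact mul_le_of_le_one_left δ.coe_nonneg hδ'
      gcongr
    have h4 : |(δ : ℝ) * u| ≤ δ * (D * B) := by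
      rw [abs_mul, abs_of_nonneg δ.coe_nonneg]
      gcongr
      exact h2.trans (by gcongr)
    rw [← add_assoc]
    have e : gridMoment μ η ρ m δ g (k + j + 1) - gridMoment μ η ρ m δ g k =
        (gridMoment μ η ρ m δ g (k + j + 1) - gridMoment μ η ρ m δ g (k + j) - δ * u) + δ * u +
        (gridMoment μ η ρ m δ g (k + j) - gridMoment μ η ρ m δ g k) := by ring
    rw [e]
    refine (abs_add_le _ _).trans ((add_le_add (abs_add_le _ _) (ih hT')).trans ?_)
    push_cast
    linarith

/-- The one-step expansions are summed, with the drift at step `k + i` replaced by the drift at step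
`k` at a cost of order `i δ`. The extra `δ` in the bound absorbs the accumulated one-step errors and
disappears in the limit. -/
lemma exists_abs_gridMoment_expansion_le (hη : IsASEP p q η ℱ μ) {ρ : ℝ} (hρ : 0 < ρ) (m : ℤ)
    {g : Config → ℝ} (hg : IsCylinder g) (T : ℝ) : ∃ C, 0 ≤ C ∧ ∀ (δ : ℝ≥0) (k j : ℕ), δ ≤ 1 →
      ((k + j : ℕ) : ℝ) * δ ≤ T →
      |gridMoment μ η ρ m δ g (k + j) - gridMoment μ η ρ m δ g k -
        j * δ * gridMoment μ η ρ m δ (tiltedGenerator p q ρ m g) k| ≤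
        C * (j * δ) * (j * δ + δ) := by
  obtain ⟨B, hB0, hB⟩ := hη.exists_gridMoment_one_le hρ m T
  obtain ⟨C, hC0, hC⟩ := hη.exists_abs_gridMoment_succ_sub_le hρ m hg
  obtain ⟨D, hD0, hD⟩ :=
    hη.exists_abs_gridMoment_add_sub_le hρ m (isCylinder_tiltedGenerator p q ρ m hg) T
  refine ⟨C * B + D, by positivity, fun δ k j hδ hT => ?_⟩
  induction j with
  | zero => simp
  | succ j ih =>
    have hT' : ((k + j : ℕ) : ℝ) * δ ≤ T := by
      refine le_trans ?_ hT
      gcongr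
      omega
    have h1 := hC δ (k + j)
    have h2 := hD δ k j hδ hT'
    have hVB := hB δ (k + j) hδ hT'
    set u := gridMoment μ η ρ m δ (tiltedGenerator p q ρ m g)
    have h3 : C * (δ : ℝ) ^ 2 * gridMoment μ η ρ m δ (fun _ => 1) (k + j) ≤
        C * (δ : ℝ) ^ 2 * B := by gcongr
    have h4 : |(δ : ℝ) * (u (k + j) - u k)| ≤ δ * (D * (j * δ)) := by
      rw [abs_mul, abs_of_nonneg δ.coe_nonneg]
      gcongr
    rw [← add_assoc]
    have e : gridMoment μ η ρ m δ g (k + j + 1) - gridMoment μ η ρ m δ g k -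
        (j + 1 : ℕ) * δ * u k =
        (gridMoment μ η ρ m δ g (k + j + 1) - gridMoment μ η ρ m δ g (k + j) - δ * u (k + j)) +
        δ * (u (k + j) - u k) +
        (gridMoment μ η ρ m δ g (k + j) - gridMoment μ η ρ m δ g k - j * δ * u k) := by
      push_cast
      ring
    rw [e]
    refine (abs_add_le _ _).trans ((add_le_add (abs_add_le _ _) (ih hT')).trans ?_)
    refine (add_le_add_left (add_le_add (h1.trans h3) h4) _).trans ?_
    push_cast
    -- This is exactly the slack between the claimed bound at `j + 1` and the sum of the three
    -- errors.
    have hx : 0 ≤ (δ : ℝ) ^ 2 * (C * B * (2 * j + 1) + D * (j + 2)) := by positivity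
    linarith

end IsASEP

/-! ### Exponential moments of the current -/

/-- The expectation of `ρ ^ (m Q(0, t)) g(η(t))`. -/
def currentMoment {Ω : Type*} {mΩ : MeasurableSpace Ω} (μ : Measure Ω) (η : ℝ≥0 → Ω → Config)
    (ρ : ℝ) (m : ℤ) (g : Config → ℝ) (t : ℝ≥0) : ℝ :=
  ∫ ω, ρ ^ (m * current (fun s => η s ω) 0 t) * g (η t ω) ∂μ

lemma hasDerivWithinAt_of_quadratic_bound {u : ℝ≥0 → ℝ} {t : ℝ≥0} {d C : ℝ}
    (h : ∀ s ≤ t + 1, |u s - u t - ((s : ℝ) - t) * d| ≤ C * ((s : ℝ) - t) ^ 2) :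
    HasDerivWithinAt (fun r : ℝ => u r.toNNReal) d (Set.Ici 0) t := by
  rw [hasDerivWithinAt_iff_isLittleO]
  have hO : (fun r : ℝ => u r.toNNReal - u (t : ℝ).toNNReal - (r - t) • d)
      =O[𝓝[Set.Ici 0] (t : ℝ)] fun r => (r - t) ^ 2 := by
    refine Asymptotics.IsBigO.of_bound C ?_
    have hnear : ∀ᶠ r : ℝ in 𝓝[Set.Ici 0] (t : ℝ), r ≤ t + 1 :=
      nhdsWithin_le_nhds (Iic_mem_nhds (by linarith))
    filter_upwards [self_mem_nhdsWithin, hnear] with r (hr0 : 0 ≤ r) hr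
    have := h r.toNNReal (by
      rw [← NNReal.coe_le_coe, Real.coe_toNNReal r hr0]
      exact_mod_cast hr)
    rw [Real.coe_toNNReal r hr0] at this
    rw [Real.toNNReal_coe, smul_eq_mul, Real.norm_eq_abs, Real.norm_eq_abs, abs_sq]
    exact this
  refine hO.trans_isLittleO (Asymptotics.IsLittleO.mono ?_ nhdsWithin_le_nhds)
  have hid : Tendsto (fun r : ℝ => r - t) (𝓝 (t : ℝ)) (𝓝 0) :=
    tendsto_sub_nhds_zero_iff.2 tendsto_id
  have hz : (fun r : ℝ => r - t) =o[𝓝 (t : ℝ)] fun _ => (1 : ℝ) :=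
    (Asymptotics.isLittleO_one_iff ℝ).2 hid
  simpa [sq] using hz.mul_isBigO (Asymptotics.isBigO_refl (fun r : ℝ => r - t) (𝓝 (t : ℝ)))

namespace IsASEP

variable {Ω : Type*} {mΩ : MeasurableSpace Ω} {μ : Measure Ω} [IsProbabilityMeasure μ]
  {ℱ : Filtration ℝ≥0 mΩ} {p q : ℝ} {η : ℝ≥0 → Ω → Config}

/-- Moments along grids converge to moments of the current as the mesh tends to zero. -/
lemma integrable_and_tendsto_gridMoment (hη : IsASEP p q η ℱ μ) {ρ : ℝ} (hρ : 0 < ρ) (m : ℤ)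
    {g : Config → ℝ} (hg : IsCylinder g) (t : ℝ≥0) :
    Integrable (fun ω => ρ ^ (m * current (fun s => η s ω) 0 t) * g (η t ω)) μ ∧
      Tendsto (fun δ => gridMoment μ η ρ m δ g ⌈t / δ⌉₊) (𝓝[>] 0)
        (𝓝 (currentMoment μ η ρ m g t)) := by
  -- Second moments of the weight are first moments with exponent `2 m`. The horizon is `t + 1`
  -- because the last grid point may exceed `t` by up to `δ ≤ 1`.
  obtain ⟨B, hB0, hB⟩ := hη.exists_gridMoment_one_le hρ (2 * m) (t + 1)
  have hg2 : IsCylinder fun ξ => g ξ ^ 2 := by simpa only [sq] using hg.mul hg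
  obtain ⟨D, hD0, hD⟩ := hg2.exists_bound
  have hsq : ∀ (δ : ℝ≥0) (k : ℕ) (ω : Ω), (gridWeight η ρ m δ k ω * g (η (k * δ) ω)) ^ 2 =
      gridWeight η ρ (2 * m) δ k ω * g (η (k * δ) ω) ^ 2 := fun δ k ω => by
    rw [mul_pow]
    simp only [gridWeight]
    rw [← zpow_natCast, ← zpow_mul]
    congr 2
    push_cast
    ring
  refine integrable_and_tendsto_integral_of_sq_bounded (l := 𝓝[>] (0 : ℝ≥0)) (K := D * B)
    (X := fun δ ω => gridWeight η ρ m δ ⌈t / δ⌉₊ ω * g (η (⌈t / δ⌉₊ * δ) ω))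
    (fun δ => ?_) (fun δ => ?_) ?_ fun ω => ?_
  · exact ((hη.measurable_gridWeight ρ m δ _).mono (ℱ.le _) le_rfl).mul
      (hη.measurable_cylinder' hg _)
  · simp only [hsq]
    exact hη.integrable_weight_mul hg2 (hη.integrable_gridWeight hρ _ _ _) _
  · have hsmall : ∀ᶠ δ : ℝ≥0 in 𝓝[>] 0, δ ≤ 1 := nhdsWithin_le_nhds (Iic_mem_nhds one_pos)
    filter_upwards [self_mem_nhdsWithin, hsmall] with δ (hδ : 0 < δ) hδ1
    simp only [hsq]
    refine (le_abs_self _).trans ((hη.abs_gridMoment_le hρ (2 * m) δ hD ⌈t / δ⌉₊).trans ?_)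
    refine mul_le_mul_of_nonneg_left (hB δ _ hδ1 ?_) hD0
    exact_mod_cast (ceil_div_mul_lt hδ t).le.trans (by gcongr)
  · refine tendsto_nhds_of_eventually_eq ?_
    filter_upwards [eventually_gridCurrent_eq (hη.right_continuous ω) (hη.left_limits ω) t,
      (tendsto_ceil_div_mul t).eventually (hg.eventually_eq (hη.right_continuous ω t).tendsto)]
      with δ h1 h2
    simp only [gridWeight, h1, h2]

lemma exists_abs_currentMoment_sub_le (hη : IsASEP p q η ℱ μ) {ρ : ℝ} (hρ : 0 < ρ) (m : ℤ)
    {g : Config → ℝ} (hg : IsCylinder g) (T : ℝ≥0) : ∃ C, 0 ≤ C ∧ ∀ s t : ℝ≥0, s ≤ t → t ≤ T →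
      |currentMoment μ η ρ m g t - currentMoment μ η ρ m g s| ≤ C * ((t : ℝ) - s) ∧
      |currentMoment μ η ρ m g t - currentMoment μ η ρ m g s -
        ((t : ℝ) - s) * currentMoment μ η ρ m (tiltedGenerator p q ρ m g) s| ≤
        C * ((t : ℝ) - s) ^ 2 := by
  obtain ⟨C₁, hC₁0, hC₁⟩ := hη.exists_abs_gridMoment_add_sub_le hρ m hg (T + 1)
  obtain ⟨C₂, hC₂0, hC₂⟩ := hη.exists_abs_gridMoment_expansion_le hρ m hg (T + 1)
  refine ⟨C₁ + C₂, by positivity, fun s t hst htT => ?_⟩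
  have hst' : 0 ≤ (t : ℝ) - s := sub_nonneg.2 (by exact_mod_cast hst)
  have hu := fun r => (hη.integrable_and_tendsto_gridMoment hρ m hg r).2
  have hv := (hη.integrable_and_tendsto_gridMoment hρ m
    (isCylinder_tiltedGenerator p q ρ m hg) s).2
  have hceil : ∀ r : ℝ≥0, Tendsto (fun δ : ℝ≥0 => ((⌈r / δ⌉₊ : ℝ) * δ)) (𝓝[>] 0) (𝓝 r) := by
    intro r
    have := ((NNReal.continuous_coe.tendsto r).comp
      ((tendsto_ceil_div_mul r).mono_right nhdsWithin_le_nhds))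
    simpa [Function.comp_def] using this
  have hstep := (hceil t).sub (hceil s)
  have hid : Tendsto (fun δ : ℝ≥0 => (δ : ℝ)) (𝓝[>] 0) (𝓝 0) := by
    simpa using (NNReal.continuous_coe.tendsto 0).mono_left nhdsWithin_le_nhds
  have hsmall : ∀ᶠ δ : ℝ≥0 in 𝓝[>] 0, δ ≤ 1 := nhdsWithin_le_nhds (Iic_mem_nhds one_pos)
  have hgrid : ∀ δ : ℝ≥0, 0 < δ → δ ≤ 1 → ∃ j : ℕ, ⌈t / δ⌉₊ = ⌈s / δ⌉₊ + j ∧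
      (j : ℝ) * δ = ⌈t / δ⌉₊ * δ - ⌈s / δ⌉₊ * δ ∧ ((⌈s / δ⌉₊ + j : ℕ) : ℝ) * δ ≤ T + 1 := by
    intro δ hδ hδ1
    obtain ⟨j, hj⟩ := Nat.exists_eq_add_of_le (Nat.ceil_mono (by gcongr : s / δ ≤ t / δ))
    refine ⟨j, hj, ?_, ?_⟩
    · rw [hj]
      push_cast
      ring
    · rw [← hj]
      exact_mod_cast (ceil_div_mul_lt hδ t).le.trans (by gcongr)
  constructor
  · refine (le_of_tendsto_of_tendsto ((hu t).sub (hu s)).abs (hstep.const_mul C₁) ?_).trans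
      (by gcongr; linarith)
    filter_upwards [self_mem_nhdsWithin, hsmall] with δ (hδ : 0 < δ) hδ1
    obtain ⟨j, h1, h2, h3⟩ := hgrid δ hδ hδ1
    rw [← h2, h1]
    exact hC₁ δ _ j hδ1 h3
  -- In the limit `j δ (j δ + δ)` becomes `(t - s)²`.
  · have hrhs := (hstep.const_mul C₂).mul (hstep.add hid)
    rw [add_zero, mul_assoc, ← sq] at hrhs
    refine (le_of_tendsto_of_tendsto (((hu t).sub (hu s)).sub (hstep.mul hv)).abs hrhs ?_).trans
      (by gcongr; linarith)
    filter_upwards [self_mem_nhdsWithin, hsmall] with δ (hδ : 0 < δ) hδ1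
    obtain ⟨j, h1, h2, h3⟩ := hgrid δ hδ hδ1
    rw [← h2, h1]
    exact hC₂ δ _ j hδ1 h3

/-- The evolution equation for the exponential moments of the current. -/
lemma hasDerivWithinAt_currentMoment (hη : IsASEP p q η ℱ μ) {ρ : ℝ} (hρ : 0 < ρ) (m : ℤ)
    {g : Config → ℝ} (hg : IsCylinder g) (t : ℝ≥0) :
    HasDerivWithinAt (fun r : ℝ => currentMoment μ η ρ m g r.toNNReal)
      (currentMoment μ η ρ m (tiltedGenerator p q ρ m g) t) (Set.Ici 0) t := by
  obtain ⟨C, hC0, hC⟩ := hη.exists_abs_currentMoment_sub_le hρ m hg (t + 1)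
  obtain ⟨D, hD0, hD⟩ := hη.exists_abs_currentMoment_sub_le hρ m
    (isCylinder_tiltedGenerator p q ρ m hg) (t + 1)
  refine hasDerivWithinAt_of_quadratic_bound (C := C + D) fun s hs => ?_
  rcases le_total t s with hts | hst
  · exact (hC t s hts hs).2.trans (by gcongr; linarith)
  -- To the left of `t` the available expansion is based at `s`; the Lipschitz bound on the drift
  -- moves its base point to `t`.
  · have h1 := (hC s t hst (by simp)).2
    have h2 := (hD s t hst (by simp)).1
    have hst' : 0 ≤ (t : ℝ) - s := sub_nonneg.2 (by exact_mod_cast hst)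
    set u := currentMoment μ η ρ m g
    set v := currentMoment μ η ρ m (tiltedGenerator p q ρ m g)
    have e : u s - u t - ((s : ℝ) - t) * v t =
        -(u t - u s - ((t : ℝ) - s) * v s) + ((t : ℝ) - s) * (v t - v s) := by ring
    rw [e]
    refine (abs_add_le _ _).trans ?_
    rw [abs_neg, abs_mul, abs_of_nonneg hst']
    have h3 := mul_le_mul_of_nonneg_left h2 hst'
    nlinarith

end IsASEP

/-! ### Products of exponentials of heights -/

/-- The relative rate of change of `τ ^ (n N(x))`, where `τ = p / q`. -/
def heightRate (p q : ℝ) (n x : ℤ) (η : Config) : ℝ :=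
  rate p q η x * ((p / q) ^ (n * (occ η (x + 1) - occ η x)) - 1)

lemma isCylinder_heightRate (p q : ℝ) (n x : ℤ) : IsCylinder (heightRate p q n x) := by
  refine .intro {x, x + 1} fun η ξ h => ?_
  simp [heightRate, rate, occ, h x (by simp), h (x + 1) (by simp)]

/-- Both sides depend only on the occupations of `x` and `x + 1`. The four coefficients solve the
linear system given by the four cases; the rate vanishes when the two occupations agree. -/
lemma heightRate_eq {p q : ℝ} (hp : 0 < p) (hpq : p < q) (n x : ℤ) (η : Config) :
    heightRate p q n x η = coeffA p q n + coeffB p q n * (p / q) ^ (-occ η x) +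
      coeffC p q n * (p / q) ^ (occ η (x + 1)) +
      coeffD p q n * (p / q) ^ (occ η (x + 1) - occ η x) := by
  have hq : 0 < q := hp.trans hpq
  obtain ⟨τ, hτ⟩ : ∃ τ, τ = p / q := ⟨_, rfl⟩
  have hτ0 : τ ≠ 0 := by rw [hτ]; positivity
  have hτ1 : 1 - τ ≠ 0 := by
    rw [hτ, sub_ne_zero]
    exact ((div_lt_one hq).2 hpq).ne'
  have hpτ : p = q * τ := by rw [hτ]; field_simp
  have hn : τ ^ n ≠ 0 := zpow_ne_zero _ hτ0
  unfold heightRate rate coeffA coeffB coeffC coeffD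
  rw [← hτ, hpτ]
  unfold occ
  cases η x <;> cases η (x + 1) <;> simp [zpow_neg] <;> field_simp <;> ring

lemma evolutionTerm_eq {p q : ℝ} (hp : 0 < p) (hpq : p < q) (n x : ℤ) (γ : ℝ≥0 → Config)
    (t : ℝ≥0) : evolutionTerm p q n γ x t =
      (p / q) ^ (n * height γ x t) * heightRate p q n x (γ t) := by
  have hτ : p / q ≠ 0 := (div_pos hp (hp.trans hpq)).ne'
  have h1 : height γ (x + 1) t = height γ x t + occ (γ t) (x + 1) := by
    rw [height_eq, height_eq, profile_succ]
    ring
  have h2 : height γ (x - 1) t = height γ x t - occ (γ t) x := by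
    have := profile_succ (γ t) (x - 1)
    rw [sub_add_cancel] at this
    rw [height_eq, height_eq, this]
    ring
  rw [evolutionTerm, heightRate_eq hp hpq, h1, h2]
  simp only [mul_add, mul_left_comm _ (coeffB p q n), mul_left_comm _ (coeffC p q n),
    mul_left_comm _ (coeffD p q n), mul_left_comm _ (coeffA p q n), ← zpow_add₀ hτ]
  rw [mul_comm _ (coeffA p q n)]
  congr 3 <;> ring_nf

/-- The product of the `τ ^ (m_i (N(y_i, t) - Q(0, t)))`, as a function of the configuration. -/
def profileProd (ρ : ℝ) {k : ℕ} (y m : Fin k → ℤ) (η : Config) : ℝ :=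
  ∏ i, ρ ^ (m i * profile η (y i))

lemma isCylinder_profileProd (ρ : ℝ) {k : ℕ} (y m : Fin k → ℤ) :
    IsCylinder (profileProd ρ y m) :=
  .prod _ fun _ _ => isCylinder_zpow_profile _ _ _

lemma zpow_sum₀ {ι : Type*} {ρ : ℝ} (hρ : ρ ≠ 0) (s : Finset ι) (f : ι → ℤ) :
    ρ ^ (∑ i ∈ s, f i) = ∏ i ∈ s, ρ ^ f i := by
  classical
  induction s using Finset.induction_on with
  | empty => simp
  | insert a s ha ih => rw [Finset.sum_insert ha, Finset.prod_insert ha, zpow_add₀ hρ, ih]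

/-- All heights share the same current, which factors out with the total exponent `∑ m_i`; this
brings mixed moments into the form `currentMoment`. -/
lemma prod_zpow_height {ρ : ℝ} (hρ : ρ ≠ 0) {k : ℕ} (y m : Fin k → ℤ) (γ : ℝ≥0 → Config)
    (t : ℝ≥0) : ∏ i, ρ ^ (m i * height γ (y i) t) =
      ρ ^ ((∑ i, m i) * current γ 0 t) * profileProd ρ y m (γ t) := by
  simp only [height_eq, mul_add, zpow_add₀ hρ, Finset.prod_mul_distrib, profileProd]
  rw [Finset.sum_mul, zpow_sum₀ hρ]

lemma tilt_profileProd {ρ : ℝ} (hρ : ρ ≠ 0) {k : ℕ} (y m : Fin k → ℤ) (ζ ξ : Config) :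
    tilt ρ (∑ i, m i) (profileProd ρ y m) ζ ξ =
      ∏ i, ρ ^ (m i * (crossing ζ ξ + profile ξ (y i))) := by
  simp only [tilt, mul_add, zpow_add₀ hρ, Finset.prod_mul_distrib, profileProd]
  rw [Finset.sum_mul, zpow_sum₀ hρ]

/-- An exchange over `(x, x + 1)`, crossing weight included, changes only the factors with `y_i =
x`. Injectivity of `y` leaves at most one such factor, so no cross terms arise. -/
lemma tiltedGenerator_profileProd {p q : ℝ} (hρ : p / q ≠ 0) {k : ℕ} {y : Fin k → ℤ}
    (hy : Function.Injective y) (m : Fin k → ℤ) (η : Config) :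
    tiltedGenerator p q (p / q) (∑ i, m i) (profileProd (p / q) y m) η =
      ∑ j, profileProd (p / q) y m η * heightRate p q (m j) (y j) η := by
  have hterm : ∀ x, tilt (p / q) (∑ i, m i) (profileProd (p / q) y m) η (exchange η x) =
      profileProd (p / q) y m η *
        ∏ i, (p / q) ^ (m i * if y i = x then occ η (x + 1) - occ η x else 0) := fun x => by
    simp only [tilt_profileProd hρ, crossing_add_profile_exchange, mul_add, zpow_add₀ hρ,
      Finset.prod_mul_distrib, profileProd]
  have hself : tilt (p / q) (∑ i, m i) (profileProd (p / q) y m) η η =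
      profileProd (p / q) y m η := tilt_self _ _ _ _
  rw [tiltedGenerator, generator, finsum_eq_sum_of_support_subset (s := Finset.univ.image y),
    Finset.sum_image fun i _ j _ h => hy h]
  · refine Finset.sum_congr rfl fun j _ => ?_
    rw [hterm, hself, Finset.prod_eq_single j]
    · simp only [if_true, heightRate]
      ring
    · intro i _ hij
      rw [if_neg fun h => hij (hy h), mul_zero, zpow_zero]
    · simp
  · intro x hx
    by_contra hxy
    have hne : ∀ i, y i ≠ x := fun i h => hxy (by simp [← h])
    refine hx ?_
    simp only [hterm, hself, hne, if_false, mul_zero, zpow_zero, Finset.prod_const_one, mul_one,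
      sub_self]

lemma prod_erase_mul_evolutionTerm {p q : ℝ} (hp : 0 < p) (hpq : p < q) {k : ℕ}
    (y m : Fin k → ℤ) (γ : ℝ≥0 → Config) (t : ℝ≥0) (j : Fin k) :
    (∏ i ∈ Finset.univ.erase j, (p / q) ^ (m i * height γ (y i) t)) *
        evolutionTerm p q (m j) γ (y j) t =
      (p / q) ^ ((∑ i, m i) * current γ 0 t) *
        (profileProd (p / q) y m (γ t) * heightRate p q (m j) (y j) (γ t)) := by
  rw [evolutionTerm_eq hp hpq, ← mul_assoc, Finset.prod_erase_mul _ _ (Finset.mem_univ j),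
    prod_zpow_height (div_pos hp (hp.trans hpq)).ne', mul_assoc]

end ASEP

end

/-! ### The evolution equations -/

theorem mainTheorem12 {Ω : Type*} {mΩ : MeasurableSpace Ω} (μ : Measure Ω) [IsProbabilityMeasure μ]
    (ℱ : Filtration ℝ≥0 mΩ)
    (p q : ℝ) (hp : 0 < p) (hpq : p < q)
    (η : ℝ≥0 → Ω → ASEP.Config) (hη : ASEP.IsASEP p q η ℱ μ) :
    -- all expectations below are those of integrable random variables
    (∀ (k : ℕ) (y m : Fin k → ℤ) (t : ℝ≥0),
      Integrable (fun ω => ∏ i, (p / q) ^ (m i * ASEP.height (fun s => η s ω) (y i) t)) μ) ∧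
    -- evolution of the moments at a single site
    (∀ (n x : ℤ) (t : ℝ≥0),
      Integrable (fun ω => (p / q) ^ (n * ASEP.height (fun s => η s ω) x t)) μ ∧
      Integrable (fun ω => ASEP.evolutionTerm p q n (fun s => η s ω) x t) μ ∧
      HasDerivWithinAt
        (fun r : ℝ => ∫ ω, (p / q) ^ (n * ASEP.height (fun s => η s ω) x r.toNNReal) ∂μ)
        (∫ ω, ASEP.evolutionTerm p q n (fun s => η s ω) x t ∂μ)
        (Set.Ici 0) (t : ℝ)) ∧
    -- evolution of the mixed moments with multiplicities at distinct sites
    (∀ (k : ℕ) (y m : Fin k → ℤ), Function.Injective y → ∀ t : ℝ≥0,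
      (∀ j, Integrable (fun ω =>
        (∏ i ∈ Finset.univ.erase j,
          (p / q) ^ (m i * ASEP.height (fun s => η s ω) (y i) t)) *
            ASEP.evolutionTerm p q (m j) (fun s => η s ω) (y j) t) μ) ∧
      HasDerivWithinAt
        (fun r : ℝ => ∫ ω,
          ∏ i, (p / q) ^ (m i * ASEP.height (fun s => η s ω) (y i) r.toNNReal) ∂μ)
        (∑ j, ∫ ω,
          (∏ i ∈ Finset.univ.erase j,
            (p / q) ^ (m i * ASEP.height (fun s => η s ω) (y i) t)) *
              ASEP.evolutionTerm p q (m j) (fun s => η s ω) (y j) t ∂μ)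
        (Set.Ici 0) (t : ℝ)) := by
  have hτ : 0 < p / q := div_pos hp (hp.trans hpq)
  have hmoment : ∀ (k : ℕ) (y m : Fin k → ℤ) (t : ℝ≥0),
      Integrable (fun ω => ∏ i, (p / q) ^ (m i * ASEP.height (fun s => η s ω) (y i) t)) μ := by
    intro k y m t
    simp only [ASEP.prod_zpow_height hτ.ne']
    exact (hη.integrable_and_tendsto_gridMoment hτ _ (ASEP.isCylinder_profileProd _ y m) t).1
  have hmixed : ∀ (k : ℕ) (y m : Fin k → ℤ), Function.Injective y → ∀ t : ℝ≥0,
      (∀ j, Integrable (fun ω =>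
        (∏ i ∈ Finset.univ.erase j,
          (p / q) ^ (m i * ASEP.height (fun s => η s ω) (y i) t)) *
            ASEP.evolutionTerm p q (m j) (fun s => η s ω) (y j) t) μ) ∧
      HasDerivWithinAt
        (fun r : ℝ => ∫ ω,
          ∏ i, (p / q) ^ (m i * ASEP.height (fun s => η s ω) (y i) r.toNNReal) ∂μ)
        (∑ j, ∫ ω,
          (∏ i ∈ Finset.univ.erase j,
            (p / q) ^ (m i * ASEP.height (fun s => η s ω) (y i) t)) *
              ASEP.evolutionTerm p q (m j) (fun s => η s ω) (y j) t ∂μ)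
        (Set.Ici 0) (t : ℝ) := by
    intro k y m hy t
    simp only [ASEP.prod_erase_mul_evolutionTerm hp hpq, ASEP.prod_zpow_height hτ.ne']
    have hint := fun j => (hη.integrable_and_tendsto_gridMoment hτ (∑ i, m i)
      ((ASEP.isCylinder_profileProd (p / q) y m).mul
        (ASEP.isCylinder_heightRate p q (m j) (y j))) t).1
    refine ⟨hint, ?_⟩
    have hderiv := hη.hasDerivWithinAt_currentMoment hτ (∑ i, m i)
      (ASEP.isCylinder_profileProd (p / q) y m) t
    rw [← integral_finsetSum _ fun j _ => hint j]
    simpa only [ASEP.currentMoment, ASEP.tiltedGenerator_profileProd hτ.ne' hy,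
      Finset.mul_sum] using hderiv
  refine ⟨hmoment, fun n x t => ?_, hmixed⟩
  have h1 := hmoment 1 (fun _ => x) (fun _ => n) t
  have h2 := hmixed 1 (fun _ => x) (fun _ => n) (Function.injective_of_subsingleton _) t
  have herase : (Finset.univ : Finset (Fin 1)).erase 0 = ∅ := rfl
  simp only [Fin.prod_univ_one, Fin.sum_univ_one, herase, Finset.prod_empty, one_mul] at h1 h2
  exact ⟨h1, by simpa [herase] using h2.1 0, h2.2⟩
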